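/- Let $\mathbb K$ be a field. For a topological space $X$ let $C^*(X;\mathbb K)$ be its singular cochain algebra (a differential graded algebra with the cup product), and for a DG algebra $A$ let $\mathrm D(A)$ be the derived category of right DG $A$-modules, i.e. the localization of the homotopy category of DG $A$-modules at the quasi-isomorphisms, with shift $(\Sigma M)^n=M^{n+1}$ and with exact triangles those isomorphic to the images of the cofibre sequences $M\xrightarrow{f}N\to C_f\to\Sigma M$. For an object $C$ of $\mathcal T=\mathrm D(A)$ put $\mathtt{thick}^0(C)=\{0\}$ (the zero objects), let $\mathtt{thick}^1(C)$ be the smallest strict full subcategory containing $C$ and closed under finite coproducts, retracts and all shifts, and for $n\ge 2$ let $\mathtt{thick}^n(C)$ be the smallest strict full subcategory closed under retracts and containing every $M$ that admits an exact triangle $M_1\to M\to M_2\to\Sigma M_1$ with $M_1\in\mathtt{thick}^{n-1}(C)$ and $M_2\in\mathtt{thick}^1(C)$. The $C$-level of $M$ is $\inf\{n\ge 0 : M\in\mathtt{thick}^n(C)\}\in\mathbb N\cup\{\infty\}$. For a continuous map $\alpha:Y\to X$, the level $\mathrm{level}_X(Y)$ of $Y$ over $X$ (of the map $\alpha$) is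 the $C^*(X;\mathbb K)$-level, in $\mathrm D(C^*(X;\mathbb K))$, of $C^*(Y;\mathbb K)$ regarded as a right DG $C^*(X;\mathbb K)$-module through $\alpha^*:C^*(X;\mathbb K)\to C^*(Y;\mathbb K)$. Let $\alpha:Y\to X$ and $\beta:Z\to X$ be continuous maps of topological spaces. If there exists a weak homotopy equivalence $f:Y\to Z$ (a continuous map inducing a bijection on path components and isomorphisms on $\pi_n$ for all $n\ge 1$ and all base points) such that $\alpha$ is homotopic to $\beta\circ f$, then $$\mathrm{level}_X(Z)=\mathrm{level}_X(Y).$$ -/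

import Mathlib

open CategoryTheory

universe u v w

set_option linter.unusedSimpArgs false

namespace DGLevel

/-! ### Differential graded algebras -/

/-- A (cohomologically and `ℤ`-) graded differential algebra over the field `K`: the differential
raises the degree by one. The equations between degrees are passed as arguments, so that
the product of `a : X i` and `b : X j` is `mul h a b : X k` for every proof `h : i + j = k`. -/
structure DGAlgebra (K : Type v) [Field K] where
  X : ℤ → Type w
  [addCommGroup : ∀ i, AddCommGroup (X i)]
  [module : ∀ i, Module K (X i)]
  d {i j : ℤ} (h : i + 1 = j) : X i →ₗ[K] X j
  d_d {i j k : ℤ} (h : i + 1 = j) (h' : j + 1 = k) (a : X i) : d h' (d h a) = 0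
  one : X 0
  mul {i j k : ℤ} (h : i + j = k) : X i →ₗ[K] X j →ₗ[K] X k
  one_mul {i : ℤ} (a : X i) : mul (zero_add i) one a = a
  mul_one {i : ℤ} (a : X i) : mul (add_zero i) a one = a
  mul_assoc {i j k ij jk ijk : ℤ} (hij : i + j = ij) (hjk : j + k = jk) (h : ij + k = ijk)
    (h' : i + jk = ijk) (a : X i) (b : X j) (c : X k) :
    mul h (mul hij a b) c = mul h' a (mul hjk b c)
  leibniz {i j k i' j' k' : ℤ} (h : i + j = k) (hi : i + 1 = i') (hj : j + 1 = j')
    (hk : k + 1 = k') (h₁ : i' + j = k') (h₂ : i + j' = k') (a : X i) (b : X j) :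
    d hk (mul h a b) = mul h₁ (d hi a) b + i.negOnePow • mul h₂ a (d hj b)

attribute [instance] DGAlgebra.addCommGroup DGAlgebra.module

/-- Morphisms of DG algebras. -/
structure DGAlgebra.Hom {K : Type v} [Field K] (A B : DGAlgebra.{v, w} K) where
  f (i : ℤ) : A.X i →ₗ[K] B.X i
  map_d {i j : ℤ} (h : i + 1 = j) (a : A.X i) : f j (A.d h a) = B.d h (f i a)
  map_one : f 0 A.one = B.one
  map_mul {i j k : ℤ} (h : i + j = k) (a : A.X i) (b : A.X j) :
    f k (A.mul h a b) = B.mul h (f i a) (f j b)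

/-! ### The cochain algebra of a simplicial set -/

section Cochains

open Simplicial

variable (K : Type v) [Field K] (S : SSet.{u})

/-- The inclusion of the front `p`-face `[0, …, p]` of the `m`-simplex. -/
def frontFace {p m : ℕ} (h : p ≤ m) : ⦋p⦌ ⟶ ⦋m⦌ :=
  SimplexCategory.mkHom
    ⟨fun a : Fin (p + 1) => (⟨a, by omega⟩ : Fin (m + 1)), fun a b hab => by simpa using hab⟩

/-- The inclusion of the back `q`-face `[m - q, …, m]` of the `m`-simplex. -/
def backFace {q m : ℕ} (h : q ≤ m) : ⦋q⦌ ⟶ ⦋m⦌ :=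
  SimplexCategory.mkHom
    ⟨fun a : Fin (q + 1) => (⟨a + (m - q), by omega⟩ : Fin (m + 1)),
      fun a b hab => by simpa using hab⟩

/-- The `K`-valued cochains of degree `n : ℤ` on `S`: functions on the `n`-simplices of `S`
(the index type is empty if `n < 0`, and then this is the zero module). -/
abbrev Cochain (n : ℤ) : Type max u v := (m : {m : ℕ // (m : ℤ) = n}) → S _⦋m⦌ → K

namespace Cochain
variable {S}

/-- The coboundary `(dφ)(σ) = ∑ₜ (-1)ᵗ φ(∂ₜ σ)`. -/
def d {i j : ℤ} (h : i + 1 = j) : Cochain K S i →ₗ[K] Cochain K S j where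
  toFun φ
    | ⟨0, _⟩ => 0
    | ⟨m + 1, hm⟩ => fun σ => ∑ t : Fin (m + 2), (-1) ^ (t : ℕ) * φ ⟨m, by omega⟩ (S.δ t σ)
  map_add' φ ψ := by
    funext ⟨m, hm⟩
    cases m with
    | zero => simp
    | succ m => funext σ; simp [mul_add, Finset.sum_add_distrib]
  map_smul' c φ := by
    funext ⟨m, hm⟩
    cases m with
    | zero => simp
    | succ m => funext σ; simp [Finset.mul_sum, mul_left_comm]

/-- The cup product `(φ ∪ ψ)(σ) = φ(front face of σ) ψ(back face of σ)`. -/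
def mul {i j k : ℤ} (h : i + j = k) :
    Cochain K S i →ₗ[K] Cochain K S j →ₗ[K] Cochain K S k :=
  LinearMap.mk₂ K
    (fun φ ψ m σ => if hij : 0 ≤ i ∧ 0 ≤ j then
      φ ⟨i.toNat, by omega⟩
        (S.map (frontFace (p := i.toNat) (m := m) (by have := m.2; omega)).op σ) *
      ψ ⟨j.toNat, by omega⟩
        (S.map (backFace (q := j.toNat) (m := m) (by have := m.2; omega)).op σ) else 0)
    (by intros; funext m σ; dsimp; split_ifs <;> simp [add_mul])
    (by intros; funext m σ; dsimp; split_ifs <;> simp [mul_assoc])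
    (by intros; funext m σ; dsimp; split_ifs <;> simp [mul_add])
    (by intros; funext m σ; dsimp; split_ifs <;> simp [mul_left_comm])

/-- The unit cochain, constant with value one. -/
def one : Cochain K S 0 := fun _ _ => 1

lemma d_succ {i j : ℤ} (h : i + 1 = j) (φ : Cochain K S i) (m : ℕ) (hm : ((m + 1 : ℕ) : ℤ) = j)
    (σ : S _⦋m + 1⦌) :
    d K h φ ⟨m + 1, hm⟩ σ =
      ∑ t : Fin (m + 2), (-1) ^ (t : ℕ) * φ ⟨m, by omega⟩ (S.δ t σ) := rfl

lemma d_zero {i j : ℤ} (h : i + 1 = j) (φ : Cochain K S i) (hm : ((0 : ℕ) : ℤ) = j) :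
    d K h φ ⟨0, hm⟩ = 0 := rfl

lemma mul_nat {p q : ℕ} {k : ℤ} (h : (p : ℤ) + q = k) (φ : Cochain K S p) (ψ : Cochain K S q)
    (m : ℕ) (hm : (m : ℤ) = k) (σ : S _⦋m⦌) :
    mul K h φ ψ ⟨m, hm⟩ σ =
      φ ⟨p, rfl⟩ (S.map (frontFace (p := p) (m := m) (by omega)).op σ) *
      ψ ⟨q, rfl⟩ (S.map (backFace (q := q) (m := m) (by omega)).op σ) := by
  rw [mul, LinearMap.mk₂_apply]
  exact dif_pos (by omega)

lemma mul_neg {i j k : ℤ} (h : i + j = k) (φ : Cochain K S i) (ψ : Cochain K S j)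
    (hij : ¬ (0 ≤ i ∧ 0 ≤ j)) : mul K h φ ψ = 0 := by
  funext m σ
  exact dif_neg hij

lemma d_d_aux (m : ℕ) (F : Fin (m + 2) → Fin (m + 3) → K)
    (hF : ∀ a b : Fin (m + 2), a ≤ b → F a b.succ = F b a.castSucc) :
    ∑ b : Fin (m + 3), ∑ a : Fin (m + 2), (-1) ^ (b : ℕ) * ((-1) ^ (a : ℕ) * F a b) = 0 := by
  rw [Finset.sum_comm, ← Finset.sum_product']
  let P := Fin (m + 2) × Fin (m + 3)
  let T : Finset P := Finset.univ.filter fun ij => (ij.2 : ℕ) ≤ (ij.1 : ℕ)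
  rw [Finset.univ_product_univ, ← Finset.sum_add_sum_compl T, ← eq_neg_iff_add_eq_zero,
    ← Finset.sum_neg_distrib]
  refine Finset.sum_bij (fun ij hij =>
    ((Fin.castLT ij.2 (lt_of_le_of_lt (Finset.mem_filter.mp hij).right (Fin.is_lt ij.1)),
      ij.1.succ) : P)) ?_ ?_ ?_ ?_
  · intro ij hij
    simp only [T, Finset.compl_filter, Finset.mem_filter_univ, Fin.val_succ,
      Fin.val_castLT] at hij ⊢
    omega
  · rintro ⟨i, j⟩ hij ⟨i', j'⟩ hij' h
    have h1 := congrArg (fun x : P => (x.1 : ℕ)) h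
    have h2 := congrArg (fun x : P => (x.2 : ℕ)) h
    simp only [Fin.val_castLT, Fin.val_succ] at h1 h2
    ext
    · change (i : ℕ) = i'
      omega
    · exact h1
  · rintro ⟨i', j'⟩ hij'
    simp only [T, Finset.compl_filter, Finset.mem_filter_univ, not_le] at hij'
    refine ⟨(j'.pred ?_, Fin.castSucc i'), ?_, ?_⟩
    · rintro rfl
      simp at hij'
    · simp only [T, Finset.mem_filter_univ, Fin.val_castSucc, Fin.val_pred]
      omega
    · simp only [Fin.castLT_castSucc, Fin.succ_pred]
  · rintro ⟨i, j⟩ hij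
    have hij' : (j : ℕ) ≤ i := (Finset.mem_filter.mp hij).right
    have := hF (Fin.castLT j (lt_of_le_of_lt hij' i.is_lt)) i (by
      simpa [Fin.le_def] using hij')
    simp only [Fin.castSucc_castLT] at this
    simp only [this, Fin.val_castLT, Fin.val_succ]
    ring

lemma d_d {i j k : ℤ} (h : i + 1 = j) (h' : j + 1 = k) (φ : Cochain K S i) :
    d K h' (d K h φ) = 0 := by
  funext ⟨m, hm⟩ σ
  rcases m with _ | _ | m
  · rfl
  · simp [d_succ, d_zero]
  · simp only [d_succ, Pi.zero_apply, Finset.mul_sum]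
    exact d_d_aux K m (fun a b => φ ⟨m, by omega⟩ (S.δ a (S.δ b σ)))
      (fun a b hab => by
        have := ConcreteCategory.congr_hom (S.δ_comp_δ hab) σ
        simp only [ConcreteCategory.comp_apply] at this
        simp only [this])

lemma map_eq {p n : ℕ} {f g : ⦋p⦌ ⟶ ⦋n⦌}
    (h : ∀ a : Fin (p + 1),
      ((f.toOrderHom a : Fin (n + 1)) : ℕ) = (g.toOrderHom a : Fin (n + 1)))
    (σ : S _⦋n⦌) : S.map f.op σ = S.map g.op σ := by
  have : f = g := by
    ext a
    exact h a
  rw [this]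

lemma map_map {p n r : ℕ} (f : ⦋p⦌ ⟶ ⦋n⦌) (g : ⦋n⦌ ⟶ ⦋r⦌) (σ : S _⦋r⦌) :
    S.map f.op (S.map g.op σ) = S.map (f ≫ g).op σ := by
  simp

lemma δ_def {n : ℕ} (t : Fin (n + 2)) (σ : S _⦋n + 1⦌) :
    S.δ t σ = S.map (SimplexCategory.δ t).op σ := rfl

lemma δ_val {n : ℕ} (t : Fin (n + 2)) (a : Fin (n + 1)) :
    ((a : ℕ) < t ∧ (((SimplexCategory.δ t).toOrderHom a : Fin (n + 2)) : ℕ) = a) ∨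
      ((t : ℕ) ≤ a ∧ (((SimplexCategory.δ t).toOrderHom a : Fin (n + 2)) : ℕ) = a + 1) := by
  change ((a : ℕ) < t ∧ ((t.succAbove a : Fin (n + 2)) : ℕ) = a) ∨
      ((t : ℕ) ≤ a ∧ ((t.succAbove a : Fin (n + 2)) : ℕ) = a + 1)
  simp only [Fin.succAbove, Fin.lt_def, Fin.val_castSucc]
  split_ifs with h
  · exact Or.inl ⟨h, rfl⟩
  · exact Or.inr ⟨not_lt.1 h, rfl⟩

lemma comp_val {p n r : ℕ} (f : ⦋p⦌ ⟶ ⦋n⦌) (g : ⦋n⦌ ⟶ ⦋r⦌) (a : Fin (p + 1)) :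
    (((f ≫ g).toOrderHom a : Fin (r + 1)) : ℕ) = (g.toOrderHom (f.toOrderHom a) : Fin (r + 1)) :=
  rfl

lemma front_val {p m : ℕ} (h : p ≤ m) (a : Fin (p + 1)) :
    (((frontFace h).toOrderHom a : Fin (m + 1)) : ℕ) = a := rfl

lemma back_val {q m : ℕ} (h : q ≤ m) (a : Fin (q + 1)) :
    (((backFace h).toOrderHom a : Fin (m + 1)) : ℕ) = a + (m - q) := rfl

lemma leibniz_nat {p q : ℕ} (φ : S _⦋p⦌ → K) (ψ : S _⦋q⦌ → K) (σ : S _⦋p + q + 1⦌) :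
    ∑ t : Fin (p + q + 2), (-1) ^ (t : ℕ) *
        (φ (S.map (frontFace (show p ≤ p + q by omega)).op (S.δ t σ)) *
          ψ (S.map (backFace (show q ≤ p + q by omega)).op (S.δ t σ))) =
      (∑ t : Fin (p + 2), (-1) ^ (t : ℕ) *
        φ (S.δ t (S.map (frontFace (show p + 1 ≤ p + q + 1 by omega)).op σ))) *
          ψ (S.map (backFace (show q ≤ p + q + 1 by omega)).op σ) +
      (-1) ^ p * (φ (S.map (frontFace (show p ≤ p + q + 1 by omega)).op σ) *
        ∑ t : Fin (q + 2), (-1) ^ (t : ℕ) *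
          ψ (S.δ t (S.map (backFace (show q + 1 ≤ p + q + 1 by omega)).op σ))) := by
  have hpq : (p + 1) + (q + 1) = p + q + 2 := by omega
  rw [Fin.sum_univ_castSucc (n := p + 1), Fin.sum_univ_succ (n := q + 1),
    ← (finCongr hpq).sum_comp, Fin.sum_univ_add]
  simp only [δ_def, map_map]
  have t1 (x : Fin (p + 1)) : S.map (frontFace (show p ≤ p + q by omega) ≫
      SimplexCategory.δ (finCongr hpq (Fin.castAdd (q + 1) x))).op σ =
      S.map (SimplexCategory.δ x.castSucc ≫
        frontFace (show p + 1 ≤ p + q + 1 by omega)).op σ := by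
    refine map_eq (fun a => ?_) σ
    have h := δ_val (finCongr hpq (Fin.castAdd (q + 1) x))
      ((frontFace (show p ≤ p + q by omega)).toOrderHom a)
    have h' := δ_val x.castSucc a
    simp only [front_val, back_val, finCongr_apply, Fin.val_cast, Fin.val_castAdd,
      Fin.val_natAdd, Fin.val_castSucc, Fin.val_last, Fin.val_succ, Fin.val_zero, comp_val] at h h' ⊢
    omega
  have t2 (x : Fin (p + 1)) : S.map (backFace (show q ≤ p + q by omega) ≫
      SimplexCategory.δ (finCongr hpq (Fin.castAdd (q + 1) x))).op σ =
      S.map (backFace (show q ≤ p + q + 1 by omega)).op σ := by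
    refine map_eq (fun a => ?_) σ
    have h := δ_val (finCongr hpq (Fin.castAdd (q + 1) x))
      ((backFace (show q ≤ p + q by omega)).toOrderHom a)
    simp only [front_val, back_val, finCongr_apply, Fin.val_cast, Fin.val_castAdd,
      Fin.val_natAdd, Fin.val_castSucc, Fin.val_last, Fin.val_succ, Fin.val_zero, comp_val] at h ⊢
    omega
  have t3 (x : Fin (q + 1)) : S.map (frontFace (show p ≤ p + q by omega) ≫
      SimplexCategory.δ (finCongr hpq (Fin.natAdd (p + 1) x))).op σ =
      S.map (frontFace (show p ≤ p + q + 1 by omega)).op σ := by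
    refine map_eq (fun a => ?_) σ
    have h := δ_val (finCongr hpq (Fin.natAdd (p + 1) x))
      ((frontFace (show p ≤ p + q by omega)).toOrderHom a)
    simp only [front_val, back_val, finCongr_apply, Fin.val_cast, Fin.val_castAdd,
      Fin.val_natAdd, Fin.val_castSucc, Fin.val_last, Fin.val_succ, Fin.val_zero, comp_val] at h ⊢
    omega
  have t4 (x : Fin (q + 1)) : S.map (backFace (show q ≤ p + q by omega) ≫
      SimplexCategory.δ (finCongr hpq (Fin.natAdd (p + 1) x))).op σ =
      S.map (SimplexCategory.δ x.succ ≫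
        backFace (show q + 1 ≤ p + q + 1 by omega)).op σ := by
    refine map_eq (fun a => ?_) σ
    have h := δ_val (finCongr hpq (Fin.natAdd (p + 1) x))
      ((backFace (show q ≤ p + q by omega)).toOrderHom a)
    have h' := δ_val x.succ a
    simp only [front_val, back_val, finCongr_apply, Fin.val_cast, Fin.val_castAdd,
      Fin.val_natAdd, Fin.val_castSucc, Fin.val_last, Fin.val_succ, Fin.val_zero, comp_val] at h h' ⊢
    omega
  have t5 : S.map (SimplexCategory.δ (Fin.last (p + 1)) ≫
        frontFace (show p + 1 ≤ p + q + 1 by omega)).op σ =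
      S.map (frontFace (show p ≤ p + q + 1 by omega)).op σ := by
    refine map_eq (fun a => ?_) σ
    have h' := δ_val (Fin.last (p + 1)) a
    simp only [front_val, back_val, finCongr_apply, Fin.val_cast, Fin.val_castAdd,
      Fin.val_natAdd, Fin.val_castSucc, Fin.val_last, Fin.val_succ, Fin.val_zero, comp_val] at h' ⊢
    omega
  have t6 : S.map (SimplexCategory.δ 0 ≫
        backFace (show q + 1 ≤ p + q + 1 by omega)).op σ =
      S.map (backFace (show q ≤ p + q + 1 by omega)).op σ := by
    refine map_eq (fun a => ?_) σ
    have h' := δ_val 0 a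
    simp only [front_val, back_val, finCongr_apply, Fin.val_cast, Fin.val_castAdd,
      Fin.val_natAdd, Fin.val_castSucc, Fin.val_last, Fin.val_succ, Fin.val_zero, comp_val] at h' ⊢
    omega
  simp only [t1, t2, t3, t4, t5, t6]
  simp only [finCongr_apply, Fin.val_cast,
    Fin.val_castAdd, Fin.val_natAdd, Fin.val_castSucc, Fin.val_last, Fin.val_succ, Fin.val_zero]
  generalize S.map (frontFace _).op σ = u
  generalize S.map (backFace _).op σ = w
  simp only [mul_add, Finset.mul_sum, Finset.sum_mul, add_mul]
  have e1 : ∀ a b c e a' b' : K, a = a' → b = b' → c + e = 0 →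
      a + b = a' + c + (e + b') := by
    intro a b c e a' b' h h' h''
    rw [h, h']
    linear_combination -h''
  refine e1 _ _ _ _ _ _ (Finset.sum_congr rfl fun x _ => ?_)
    (Finset.sum_congr rfl fun x _ => ?_) ?_ <;> ring

lemma leibniz {i j k i' j' k' : ℤ} (h : i + j = k) (hi : i + 1 = i') (hj : j + 1 = j')
    (hk : k + 1 = k') (h₁ : i' + j = k') (h₂ : i + j' = k')
    (φ : Cochain K S i) (ψ : Cochain K S j) :
    d K hk (mul K h φ ψ) =
      mul K h₁ (d K hi φ) ψ + i.negOnePow • mul K h₂ φ (d K hj ψ) := by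
  rcases lt_or_ge i 0 with hi0 | hi0
  · rw [mul_neg K h _ _ (by omega), mul_neg K h₂ _ _ (by omega), map_zero, smul_zero, add_zero]
    by_cases hi' : i' = 0
    · have : d K hi φ = 0 := by
        funext ⟨m, hm⟩
        obtain rfl : m = 0 := by omega
        rfl
      rw [this, map_zero, LinearMap.zero_apply]
    · rw [mul_neg K h₁ _ _ (by omega)]
  rcases lt_or_ge j 0 with hj0 | hj0
  · rw [mul_neg K h _ _ (by omega), mul_neg K h₁ _ _ (by omega), map_zero, zero_add]
    by_cases hj' : j' = 0
    · have : d K hj ψ = 0 := by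
        funext ⟨m, hm⟩
        obtain rfl : m = 0 := by omega
        rfl
      rw [this, map_zero, smul_zero]
    · rw [mul_neg K h₂ _ _ (by omega), smul_zero]
  obtain ⟨p, rfl⟩ := Int.eq_ofNat_of_zero_le hi0
  obtain ⟨q, rfl⟩ := Int.eq_ofNat_of_zero_le hj0
  obtain rfl : i' = ((p + 1 : ℕ) : ℤ) := by omega
  obtain rfl : j' = ((q + 1 : ℕ) : ℤ) := by omega
  funext ⟨m, hm⟩ σ
  obtain rfl : m = p + q + 1 := by omega
  have hsign : ((p : ℤ).negOnePow • mul K h₂ φ (d K hj ψ)) ⟨p + q + 1, hm⟩ σ =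
      (-1) ^ p * mul K h₂ φ (d K hj ψ) ⟨p + q + 1, hm⟩ σ := by
    rw [Units.smul_def]
    simp [Int.negOnePow_def]
  rw [Pi.add_apply, Pi.add_apply, hsign, d_succ, mul_nat, mul_nat]
  simp only [d_succ, mul_nat]
  exact leibniz_nat K (φ ⟨p, rfl⟩) (ψ ⟨q, rfl⟩) σ

lemma one_mul {i : ℤ} (φ : Cochain K S i) : mul K (zero_add i) (one K) φ = φ := by
  funext ⟨m, hm⟩ σ
  obtain rfl := hm
  have : S.map (backFace (le_refl m)).op σ = S.map (𝟙 _) σ :=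
    map_eq (g := 𝟙 _) (fun a => by simp [back_val]) σ
  refine (mul_nat K (p := 0) (by simp) _ _ m rfl σ).trans ?_
  rw [this]
  simp [one]

lemma mul_one {i : ℤ} (φ : Cochain K S i) : mul K (add_zero i) φ (one K) = φ := by
  funext ⟨m, hm⟩ σ
  obtain rfl := hm
  have : S.map (frontFace (le_refl m)).op σ = S.map (𝟙 _) σ :=
    map_eq (g := 𝟙 _) (fun a => by simp [front_val]) σ
  refine (mul_nat K (q := 0) (by simp) _ _ m rfl σ).trans ?_
  rw [this]
  simp [one]

lemma mul_assoc {i j k ij jk ijk : ℤ} (hij : i + j = ij) (hjk : j + k = jk) (h : ij + k = ijk)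
    (h' : i + jk = ijk) (a : Cochain K S i) (b : Cochain K S j) (c : Cochain K S k) :
    mul K h (mul K hij a b) c = mul K h' a (mul K hjk b c) := by
  by_cases hi : 0 ≤ i
  swap
  · rw [mul_neg K hij a b (by omega), mul_neg K h' _ _ (by omega), map_zero, LinearMap.zero_apply]
  by_cases hj : 0 ≤ j
  swap
  · rw [mul_neg K hij a b (by omega), mul_neg K hjk _ _ (by omega), map_zero, map_zero,
      LinearMap.zero_apply]
  by_cases hk : 0 ≤ k
  swap
  · rw [mul_neg K h _ c (by omega), mul_neg K hjk _ _ (by omega), map_zero]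
  obtain ⟨p, rfl⟩ := Int.eq_ofNat_of_zero_le hi
  obtain ⟨q, rfl⟩ := Int.eq_ofNat_of_zero_le hj
  obtain ⟨r, rfl⟩ := Int.eq_ofNat_of_zero_le hk
  obtain rfl : ij = ((p + q : ℕ) : ℤ) := by omega
  obtain rfl : jk = ((q + r : ℕ) : ℤ) := by omega
  funext ⟨m, hm⟩ σ
  rw [mul_nat, mul_nat, mul_nat, mul_nat, map_map, map_map, map_map, map_map, _root_.mul_assoc]
  refine congrArg₂ (· * ·) (congrArg _ (map_eq (fun a => ?_) σ))
    (congrArg₂ (· * ·) (congrArg _ (map_eq (fun a => ?_) σ)) (congrArg _ (map_eq (fun a => ?_) σ)))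
  · simp only [comp_val, front_val]
  · simp only [comp_val, front_val, back_val]
    omega
  · simp only [comp_val, back_val]
    omega

/-- Pullback of cochains along a map of simplicial sets. -/
def map {S T : SSet.{u}} (f : S ⟶ T) (n : ℤ) : Cochain K T n →ₗ[K] Cochain K S n where
  toFun φ m σ := φ m (f.app _ σ)
  map_add' _ _ := rfl
  map_smul' _ _ := rfl

variable {T : SSet.{u}} (f : S ⟶ T)

lemma map_d {i j : ℤ} (h : i + 1 = j) (φ : Cochain K T i) :
    map K f j (d K h φ) = d K h (map K f i φ) := by
  funext ⟨m, hm⟩ σ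
  rcases m with _ | m
  · rfl
  · change d K h φ ⟨m + 1, hm⟩ (f.app _ σ) = _
    simp only [d_succ]
    refine Finset.sum_congr rfl fun t _ => ?_
    exact congrArg (fun x => (-1) ^ (t : ℕ) * φ ⟨m, by omega⟩ x)
      (ConcreteCategory.congr_hom (f.naturality (SimplexCategory.δ t).op) σ).symm

lemma map_mul {i j k : ℤ} (h : i + j = k) (φ : Cochain K T i) (ψ : Cochain K T j) :
    map K f k (mul K h φ ψ) = mul K h (map K f i φ) (map K f j ψ) := by
  by_cases hij : 0 ≤ i ∧ 0 ≤ j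
  swap
  · rw [mul_neg K h _ _ hij, mul_neg K h _ _ hij, map_zero]
  obtain ⟨p, rfl⟩ := Int.eq_ofNat_of_zero_le hij.1
  obtain ⟨q, rfl⟩ := Int.eq_ofNat_of_zero_le hij.2
  funext ⟨m, hm⟩ σ
  have hp : p ≤ m := by omega
  have hq : q ≤ m := by omega
  change mul K h φ ψ ⟨m, hm⟩ (f.app _ σ) = _
  rw [mul_nat, mul_nat]
  exact congrArg₂ (· * ·)
    (congrArg (φ ⟨p, rfl⟩)
      (ConcreteCategory.congr_hom (f.naturality (frontFace hp).op) σ).symm)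
    (congrArg (ψ ⟨q, rfl⟩)
      (ConcreteCategory.congr_hom (f.naturality (backFace hq).op) σ).symm)

lemma map_one : map K f 0 (one K) = one K := rfl

end Cochain

/-- The DG algebra of `K`-valued cochains on a simplicial set, with the cup product. -/
def cochainAlgebra : DGAlgebra.{v, max u v} K where
  X n := Cochain K S n
  d h := Cochain.d K h
  d_d h h' a := Cochain.d_d K h h' a
  one := Cochain.one K
  mul h := Cochain.mul K h
  one_mul a := Cochain.one_mul K a
  mul_one a := Cochain.mul_one K a
  mul_assoc hij hjk h h' a b c := Cochain.mul_assoc K hij hjk h h' a b c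
  leibniz h hi hj hk h₁ h₂ a b := Cochain.leibniz K h hi hj hk h₁ h₂ a b

/-- The morphism of cochain algebras induced by a map of simplicial sets. -/
def cochainMap {S T : SSet.{u}} (f : S ⟶ T) : (cochainAlgebra K T).Hom (cochainAlgebra K S) where
  f := Cochain.map K f
  map_d h a := Cochain.map_d K f h a
  map_one := rfl
  map_mul h a b := Cochain.map_mul K f h a b

end Cochains

/-! ### Differential graded modules -/

section Modules

variable {K : Type v} [Field K]

/-- Right DG modules over a DG algebra. -/
structure DGModule (A : DGAlgebra.{v, w} K) where
  X : ℤ → Type w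
  [addCommGroup : ∀ i, AddCommGroup (X i)]
  [module : ∀ i, Module K (X i)]
  d {i j : ℤ} (h : i + 1 = j) : X i →ₗ[K] X j
  d_d {i j k : ℤ} (h : i + 1 = j) (h' : j + 1 = k) (m : X i) : d h' (d h m) = 0
  act {i j k : ℤ} (h : i + j = k) : X i →ₗ[K] A.X j →ₗ[K] X k
  act_one {i : ℤ} (m : X i) : act (add_zero i) m A.one = m
  act_mul {i j k ij jk ijk : ℤ} (hij : i + j = ij) (hjk : j + k = jk) (h : ij + k = ijk)
    (h' : i + jk = ijk) (m : X i) (a : A.X j) (b : A.X k) :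
    act h (act hij m a) b = act h' m (A.mul hjk a b)
  leibniz {i j k i' j' k' : ℤ} (h : i + j = k) (hi : i + 1 = i') (hj : j + 1 = j')
    (hk : k + 1 = k') (h₁ : i' + j = k') (h₂ : i + j' = k') (m : X i) (a : A.X j) :
    d hk (act h m a) = act h₁ (d hi m) a + i.negOnePow • act h₂ m (A.d hj a)

attribute [instance] DGModule.addCommGroup DGModule.module

/-- For a morphism `φ : A → B` of DG algebras, `B` as a right DG `A`-module via `φ`. -/
def DGAlgebra.Hom.restrict {A B : DGAlgebra.{v, w} K} (φ : A.Hom B) : DGModule A where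
  X := B.X
  d h := B.d h
  d_d h h' := B.d_d h h'
  act {_ j _} h := (B.mul h).compl₂ (φ.f j)
  act_one m := by simp [φ.map_one, B.mul_one]
  act_mul hij hjk h h' m a b := by simp [φ.map_mul, B.mul_assoc hij hjk h h']
  leibniz h hi hj hk h₁ h₂ m a := by simp [φ.map_d, B.leibniz h hi hj hk h₁ h₂]

/-- `A` as a right DG module over itself. -/
def DGAlgebra.regular (A : DGAlgebra.{v, w} K) : DGModule A where
  X := A.X
  d h := A.d h
  d_d h h' := A.d_d h h'
  act h := A.mul h
  act_one := A.mul_one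
  act_mul := A.mul_assoc
  leibniz := A.leibniz

namespace DGModule
variable {A : DGAlgebra.{v, w} K}

/-- Morphisms of DG modules: `A`-linear chain maps of degree zero. -/
@[ext]
structure Hom (M N : DGModule A) where
  f (i : ℤ) : M.X i →ₗ[K] N.X i
  map_d {i j : ℤ} (h : i + 1 = j) (m : M.X i) : f j (M.d h m) = N.d h (f i m)
  map_act {i j k : ℤ} (h : i + j = k) (m : M.X i) (a : A.X j) :
    f k (M.act h m a) = N.act h (f i m) a

instance : Category (DGModule A) where
  Hom := Hom
  id M := { f := fun _ => LinearMap.id, map_d := fun _ _ => rfl, map_act := fun _ _ _ => rfl }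
  comp f g :=
    { f := fun i => (g.f i).comp (f.f i)
      map_d := fun h m => by simp [f.map_d, g.map_d]
      map_act := fun h m a => by simp [f.map_act, g.map_act] }

@[ext]
lemma hom_ext {M N : DGModule A} {f g : M ⟶ N} (h : ∀ i m, f.f i m = g.f i m) : f = g :=
  Hom.ext (funext fun i => LinearMap.ext (h i))

@[simp] lemma id_f (M : DGModule A) (i : ℤ) (m : M.X i) : Hom.f (𝟙 M) i m = m := rfl
@[simp] lemma comp_f {M N P : DGModule A} (f : M ⟶ N) (g : N ⟶ P) (i : ℤ) (m : M.X i) :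
    Hom.f (f ≫ g) i m = g.f i (f.f i m) := rfl

/-- Two morphisms are homotopic if `f - g = d s + s d` for an `A`-linear map `s` of degree `-1`. -/
def Homotopic {M N : DGModule A} (f g : M ⟶ N) : Prop :=
  ∃ s : ∀ {i j : ℤ}, j + 1 = i → (M.X i →ₗ[K] N.X j),
    (∀ {i j k i' k' : ℤ} (h : i + j = k) (hi : i' + 1 = i) (hk : k' + 1 = k) (h' : i' + j = k')
      (m : M.X i) (a : A.X j), s hk (M.act h m a) = N.act h' (s hi m) a) ∧
    ∀ {i j k : ℤ} (hij : j + 1 = i) (hik : i + 1 = k) (m : M.X i),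
      f.f i m - g.f i m = N.d hij (s hij m) + s hik (M.d hik m)

/-- The cocycles of degree `i`. -/
def cocycles (M : DGModule A) (i : ℤ) : Submodule K (M.X i) :=
  LinearMap.ker (M.d (rfl : i + 1 = i + 1))

/-- The coboundaries of degree `i`. -/
def coboundaries (M : DGModule A) (i : ℤ) : Submodule K (M.X i) :=
  LinearMap.range (M.d (sub_add_cancel i 1))

/-- The cohomology of degree `i`. -/
abbrev cohomology (M : DGModule A) (i : ℤ) : Type w :=
  M.cocycles i ⧸ (M.coboundaries i).submoduleOf (M.cocycles i)

/-- The map induced on cocycles. -/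
def cocyclesMap {M N : DGModule A} (f : M ⟶ N) (i : ℤ) : M.cocycles i →ₗ[K] N.cocycles i :=
  (f.f i).restrict fun m hm => by
    rw [cocycles, LinearMap.mem_ker] at hm ⊢
    rw [← f.map_d, hm, map_zero]

/-- The map induced on cohomology. -/
def cohomologyMap {M N : DGModule A} (f : M ⟶ N) (i : ℤ) : M.cohomology i →ₗ[K] N.cohomology i :=
  Submodule.mapQ _ _ (cocyclesMap f i) fun m hm => by
    obtain ⟨y, hy⟩ := hm
    exact ⟨f.f _ y, (f.map_d _ y).symm.trans (congrArg (f.f i) hy)⟩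

variable (A) in
/-- Quasi-isomorphisms: the morphisms that induce isomorphisms on cohomology. -/
def quasiIso : MorphismProperty (DGModule A) := fun _ _ f =>
  ∀ i, Function.Bijective (cohomologyMap f i)

/-- The shift `(Σⁿ M)ⁱ = Mⁱ⁺ⁿ`, with differential `(-1)ⁿ d` and the same right action. -/
def shift (M : DGModule A) (n : ℤ) : DGModule A where
  X i := M.X (i + n)
  d h := n.negOnePow • M.d (by omega)
  d_d h h' m := by
    simp [M.d_d]
  act h := M.act (by omega)
  act_one m := M.act_one m
  act_mul hij hjk h h' := M.act_mul _ _ _ _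
  leibniz {i j k i' j' k'} h hi hj hk h₁ h₂ m a := by
    simp only [LinearMap.smul_apply]
    rw [M.leibniz (i' := i' + n) (j' := j') (k' := k' + n) _ (by omega) hj _ (by omega) (by omega),
      smul_add, smul_smul, ← Int.negOnePow_add, show n + (i + n) = i + (n + n) by ring,
      Int.negOnePow_add i, Int.negOnePow_even (n + n) ⟨n, rfl⟩, _root_.mul_one]
    simp only [Units.smul_def, map_zsmul, LinearMap.smul_apply]

lemma shift_d (M : DGModule A) (n : ℤ) {i j : ℤ} (h : i + 1 = j) (h' : i + n + 1 = j + n)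
    (m : M.X (i + n)) : (M.shift n).d h m = (n.negOnePow : ℤ) • M.d h' m := rfl

/-- The shift of a morphism. -/
def shiftMap {M N : DGModule A} (f : M ⟶ N) (n : ℤ) : M.shift n ⟶ N.shift n where
  f i := f.f (i + n)
  map_d {i j} h m := by
    have h' : i + n + 1 = j + n := by omega
    change f.f (j + n) ((n.negOnePow : ℤ) • M.d h' (show M.X (i + n) from m)) =
      (n.negOnePow : ℤ) • N.d h' (f.f (i + n) m)
    rw [map_zsmul, f.map_d]
  map_act h m a := f.map_act _ m a

variable (A) in
/-- The shift functor. -/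
def shiftFunctor (n : ℤ) : DGModule A ⥤ DGModule A where
  obj M := M.shift n
  map f := shiftMap f n

/-- Transport along an equality of degrees. -/
def castX (M : DGModule A) {i j : ℤ} (h : i = j) : M.X i →ₗ[K] M.X j := h ▸ LinearMap.id

@[simp] lemma castX_rfl (M : DGModule A) {i : ℤ} (h : i = i) (m : M.X i) : M.castX h m = m := rfl

@[simp] lemma castX_castX (M : DGModule A) {i j k : ℤ} (h : i = j) (h' : j = k) (m : M.X i) :
    M.castX h' (M.castX h m) = M.castX (h.trans h') m := by
  subst h h'
  rfl

lemma castX_d (M : DGModule A) {i j i' j' : ℤ} (h : i + 1 = j) (hi : i = i') (hj : j = j')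
    (m : M.X i) : M.castX hj (M.d h m) = M.d (by omega) (M.castX hi m) := by
  subst hi hj
  rfl

lemma castX_act (M : DGModule A) {i j k i' k' : ℤ} (h : i + j = k) (hi : i = i') (hk : k = k')
    (m : M.X i) (a : A.X j) :
    M.castX hk (M.act h m a) = M.act (by omega) (M.castX hi m) a := by
  subst hi hk
  rfl

lemma map_castX {M N : DGModule A} (f : M ⟶ N) {i j : ℤ} (h : i = j) (m : M.X i) :
    f.f j (M.castX h m) = N.castX h (f.f i m) := by
  subst h
  rfl

lemma shift_castX (M : DGModule A) (n : ℤ) {i j : ℤ} (h : i = j) (m : (M.shift n).X i) :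
    (M.shift n).castX h m = M.castX (congrArg (· + n) h) m := by
  subst h
  rfl

/-- `Σ⁰ M ≅ M`. -/
def shiftZero (M : DGModule A) : M.shift 0 ≅ M where
  hom :=
    { f := fun i => M.castX (add_zero i)
      map_d := fun h m => by
        simp only [shift, Int.negOnePow_zero, one_smul]
        exact M.castX_d _ _ _ m
      map_act := fun h m a => M.castX_act _ _ _ m a }
  inv :=
    { f := fun i => M.castX (add_zero i).symm
      map_d := fun h m => by
        simp only [shift, Int.negOnePow_zero, one_smul]
        exact M.castX_d _ _ _ m
      map_act := fun h m a => M.castX_act _ _ _ m a }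
  hom_inv_id := hom_ext fun i m => M.castX_castX _ _ m
  inv_hom_id := hom_ext fun i m => M.castX_castX _ _ m

lemma negOnePow_add_int (a b : ℤ) :
    ((a + b).negOnePow : ℤ) = b.negOnePow * a.negOnePow := by
  rw [add_comm, Int.negOnePow_add, Units.val_mul]

/-- `Σᵃ⁺ᵇ M ≅ Σᵇ Σᵃ M`. -/
def shiftAdd (M : DGModule A) (a b : ℤ) : M.shift (a + b) ≅ (M.shift a).shift b where
  hom :=
    { f := fun i => M.castX (show i + (a + b) = i + b + a by omega)
      map_d := fun {i j} h (m : M.X (i + (a + b))) => by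
        have h₁ : i + (a + b) + 1 = j + (a + b) := by omega
        have h₂ : i + b + a + 1 = j + b + a := by omega
        change M.castX (show j + (a + b) = j + b + a by omega)
          (((a + b).negOnePow : ℤ) • M.d h₁ m) = (b.negOnePow : ℤ) • ((a.negOnePow : ℤ) •
            M.d h₂ (M.castX (show i + (a + b) = i + b + a by omega) m))
        rw [map_zsmul, smul_smul, negOnePow_add_int, M.castX_d]
      map_act := fun h m a => M.castX_act _ _ _ m a }
  inv :=
    { f := fun i => M.castX (show i + b + a = i + (a + b) by omega)
      map_d := fun {i j} h (m : M.X (i + b + a)) => by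
        have h₁ : i + (a + b) + 1 = j + (a + b) := by omega
        have h₂ : i + b + a + 1 = j + b + a := by omega
        change M.castX (show j + b + a = j + (a + b) by omega)
          ((b.negOnePow : ℤ) • ((a.negOnePow : ℤ) • M.d h₂ m)) =
            ((a + b).negOnePow : ℤ) •
            M.d h₁ (M.castX (show i + b + a = i + (a + b) by omega) m)
        rw [map_zsmul, map_zsmul, smul_smul, negOnePow_add_int, M.castX_d]
      map_act := fun h m a => M.castX_act _ _ _ m a }
  hom_inv_id := hom_ext fun i m => M.castX_castX _ _ m
  inv_hom_id := hom_ext fun i m => M.castX_castX _ _ m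

lemma eqToHom_shift_f (M : DGModule A) {a b : ℤ} (h : a = b)
    (h' : (shiftFunctor A a).obj M = (shiftFunctor A b).obj M) (i : ℤ) (m : M.X (i + a)) :
    Hom.f (eqToHom h') i m = M.castX (congrArg (i + ·) h) m := by
  subst h
  rfl

instance : HasShift (DGModule A) ℤ := hasShiftMk _ _
  { F := shiftFunctor A
    zero := NatIso.ofComponents (fun M => M.shiftZero)
      (fun f => hom_ext fun i m => (map_castX f _ m).symm)
    add := fun a b => NatIso.ofComponents (fun M => M.shiftAdd a b)
      (fun f => hom_ext fun i m => (map_castX f _ m).symm)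
    assoc_hom_app := fun a b c M => hom_ext fun i (m : M.X (i + (a + b + c))) => by
      refine Eq.trans ?_ (congrArg (fun x => Hom.f ((M.shift a).shiftAdd b c).hom i
        (Hom.f (M.shiftAdd a (b + c)).hom i x)) (eqToHom_shift_f M (add_assoc a b c) _ i m).symm)
      refine (M.castX_castX _ _ m).trans ?_
      refine Eq.trans ?_ (shift_castX M a _ _).symm
      exact (((congrArg _ (M.castX_castX _ _ m))).trans (M.castX_castX _ _ m)).symm
    zero_add_hom_app := fun n M => hom_ext fun i (m : M.X (i + (0 + n))) => by
      refine Eq.trans ?_ (congrArg (fun x => Hom.f M.shiftZero.inv (i + n) x)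
        (eqToHom_shift_f M (zero_add n) _ i m).symm)
      exact (M.castX_castX _ _ m).symm
    add_zero_hom_app := fun n M => hom_ext fun i (m : M.X (i + (n + 0))) => by
      refine Eq.trans ?_ (congrArg (fun x => Hom.f (M.shift n).shiftZero.inv i x)
        (eqToHom_shift_f M (add_zero n) _ i m).symm)
      refine Eq.trans ?_ (shift_castX M n _ _).symm
      exact (M.castX_castX _ _ m).symm }

lemma shift_map_f {M N : DGModule A} (f : M ⟶ N) (n i : ℤ) (m : M.X (i + n)) :
    Hom.f (f⟦n⟧') i m = f.f (i + n) m := rfl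

/-- Elementwise form of bijectivity on the cohomology of degree `i`. -/
def IsoAt {M N : DGModule A} (f : M ⟶ N) (k i j : ℤ) (hk : k + 1 = i) (hj : i + 1 = j) : Prop :=
  (∀ z : M.X i, M.d hj z = 0 → (∃ y, N.d hk y = f.f i z) → ∃ x, M.d hk x = z) ∧
  ∀ w : N.X i, N.d hj w = 0 → ∃ z, M.d hj z = 0 ∧ ∃ y, N.d hk y = w - f.f i z

lemma bijective_iff {M N : DGModule A} (f : M ⟶ N) (i : ℤ) :
    Function.Bijective (cohomologyMap f i) ↔
      IsoAt f (i - 1) i (i + 1) (sub_add_cancel i 1) rfl := by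
  refine and_congr ?_ ?_
  · rw [injective_iff_map_eq_zero]
    constructor
    · rintro h z hz ⟨y, hy⟩
      have := h (Submodule.Quotient.mk ⟨z, hz⟩)
        ((Submodule.Quotient.mk_eq_zero _).2 ⟨y, hy⟩)
      exact (Submodule.Quotient.mk_eq_zero _).1 this
    · intro h z
      obtain ⟨⟨z, hz⟩, rfl⟩ := Submodule.Quotient.mk_surjective _ z
      intro h0
      exact (Submodule.Quotient.mk_eq_zero _).2
        (h z hz ((Submodule.Quotient.mk_eq_zero _).1 h0))
  · constructor
    · intro h w hw
      obtain ⟨z, hz⟩ := h (Submodule.Quotient.mk ⟨w, hw⟩)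
      obtain ⟨⟨z, hz'⟩, rfl⟩ := Submodule.Quotient.mk_surjective _ z
      exact ⟨z, hz', (Submodule.Quotient.eq _).1 hz.symm⟩
    · intro h w
      obtain ⟨⟨w, hw⟩, rfl⟩ := Submodule.Quotient.mk_surjective _ w
      obtain ⟨z, hz, hy⟩ := h w hw
      exact ⟨Submodule.Quotient.mk ⟨z, hz⟩, ((Submodule.Quotient.eq _).2 hy).symm⟩

lemma quasiIso_iff {M N : DGModule A} (f : M ⟶ N) :
    quasiIso A f ↔ ∀ {k i j : ℤ} (hk : k + 1 = i) (hj : i + 1 = j), IsoAt f k i j hk hj := by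
  constructor
  · intro h k i j hk hj
    obtain rfl : k = i - 1 := by omega
    subst hj
    exact (bijective_iff f i).1 (h i)
  · intro h i
    exact (bijective_iff f i).2 (h _ _)

lemma zsmul_eq_zero_iff (n : ℤ) {V : Type*} [AddCommGroup V] (v : V) :
    (n.negOnePow : ℤ) • v = 0 ↔ v = 0 := by
  rw [← Units.smul_def]
  exact smul_eq_zero_iff_eq _

lemma shift_isoAt {M N : DGModule A} (f : M ⟶ N) (n : ℤ) {k i j : ℤ} (hk : k + 1 = i)
    (hj : i + 1 = j) : IsoAt (f⟦n⟧') k i j hk hj ↔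
      IsoAt f (k + n) (i + n) (j + n) (by omega) (by omega) := by
  have hk' : k + n + 1 = i + n := by omega
  have hj' : i + n + 1 = j + n := by omega
  have hz (P : DGModule A) (z : P.X (i + n)) :
      (P.shift n).d hj z = 0 ↔ P.d hj' z = 0 := by
    rw [P.shift_d n hj hj']
    exact zsmul_eq_zero_iff n _
  have hb (P : DGModule A) (z : P.X (i + n)) :
      (∃ y, (P.shift n).d hk y = z) ↔ ∃ y, P.d hk' y = z := by
    constructor
    · rintro ⟨y, rfl⟩
      exact ⟨(n.negOnePow : ℤ) • (show P.X (k + n) from y), (map_zsmul _ _ _)⟩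
    · rintro ⟨y, rfl⟩
      refine ⟨((n.negOnePow : ℤ) • y : P.X (k + n)), ?_⟩
      rw [P.shift_d n hk hk', map_zsmul, smul_smul, ← Units.val_mul]
      simp only [Int.units_mul_self, Units.val_one, one_smul]
      rfl
  refine and_congr ?_ ?_
  · exact forall_congr' fun z => imp_congr (hz M z) (imp_congr (hb N (f.f (i + n) z)) (hb M z))
  · exact forall_congr' fun (w : N.X (i + n)) => imp_congr (hz N w)
      (exists_congr fun (z : M.X (i + n)) => and_congr (hz M z) (hb N (w - f.f (i + n) z)))

instance : (quasiIso A).IsCompatibleWithShift ℤ where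
  condition n := by
    ext M N f
    rw [MorphismProperty.inverseImage_iff, quasiIso_iff, quasiIso_iff]
    constructor
    · intro h k i j hk hj
      have := (shift_isoAt f n (k := k - n) (i := i - n) (j := j - n) (by omega) (by omega)).1
        (h _ _)
      have e : ∀ {k i j k' i' j' : ℤ} (hk : k + 1 = i) (hj : i + 1 = j) (hk' : k' + 1 = i')
        (hj' : i' + 1 = j'), k = k' → IsoAt f k i j hk hj → IsoAt f k' i' j' hk' hj' := by
        intro k i j k' i' j' hk hj hk' hj' e h
        subst hk hj hk' hj' e
        exact h
      exact e _ _ _ _ (by omega) this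
    · intro h k i j hk hj
      exact (shift_isoAt f n hk hj).2 (h _ _)

/-- The mapping cone `C_f`, with `C_fⁱ = Nⁱ ⊕ Mⁱ⁺¹` and `d (y, x) = (d y + f x, - d x)`. -/
def cone {M N : DGModule A} (f : M ⟶ N) : DGModule A where
  X i := N.X i × M.X (i + 1)
  d {i j} h := LinearMap.prod
    ((N.d h).comp (LinearMap.fst K _ _) +
      ((f.f j).comp (M.castX h)).comp (LinearMap.snd K _ _))
    (-(M.d (by omega)).comp (LinearMap.snd K _ _))
  d_d h h' m := by
    subst h
    subst h'
    simp [N.d_d, M.d_d, f.map_d]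
  act h := LinearMap.mk₂ K (fun m a => (N.act h m.1 a, M.act (by omega) m.2 a))
    (by intros; simp) (by intros; simp) (by intros; simp) (by intros; simp)
  act_one m := Prod.ext (N.act_one _) (M.act_one _)
  act_mul hij hjk h h' m a b := Prod.ext (N.act_mul _ _ _ _ _ _ _) (M.act_mul _ _ _ _ _ _ _)
  leibniz {i j k i' j' k'} h hi hj hk h₁ h₂ m a := by
    obtain ⟨y, x⟩ := m
    refine Prod.ext ?_ ?_
    · change N.d hk (N.act h y a) + f.f k' (M.castX hk (M.act _ x a)) =
        N.act h₁ (N.d hi y + f.f i' (M.castX hi x)) a + i.negOnePow • N.act h₂ y (A.d hj a)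
      rw [N.leibniz h hi hj hk h₁ h₂, M.castX_act _ hi hk, f.map_act, map_add, LinearMap.add_apply]
      abel
    · change -M.d _ (M.act _ x a) =
        M.act _ (-M.d _ x) a + i.negOnePow • M.act _ x (A.d hj a)
      rw [M.leibniz (by omega) (show i + 1 + 1 = i' + 1 by omega) hj (by omega) (by omega)
        (by omega), Int.negOnePow_succ, map_neg, LinearMap.neg_apply, neg_add, Units.neg_smul,
        neg_neg]

/-- The inclusion `N → C_f`. -/
def coneInr {M N : DGModule A} (f : M ⟶ N) : N ⟶ cone f where
  f _ := LinearMap.inl K _ _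
  map_d h m := Prod.ext
    (show N.d h m = N.d h m + f.f _ (M.castX h 0) by simp)
    (show 0 = -M.d _ 0 by simp)
  map_act h m a := Prod.ext rfl
    (show 0 = M.act _ 0 a by simp)

/-- The projection `C_f → Σ M`. -/
def coneProj {M N : DGModule A} (f : M ⟶ N) : cone f ⟶ M⟦(1 : ℤ)⟧ where
  f i := LinearMap.snd K (N.X i) (M.X (i + 1))
  map_d {i j} h m := by
    change -M.d _ m.2 = (Int.negOnePow 1 : ℤ) • M.d _ m.2
    simp
  map_act _ _ _ := rfl

/-- The cofibre sequence `M → N → C_f → Σ M`. -/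
def coneTriangle {M N : DGModule A} (f : M ⟶ N) : Pretriangulated.Triangle (DGModule A) :=
  Pretriangulated.Triangle.mk f (coneInr f) (coneProj f)

variable (A) in
/-- The homotopy relation on morphisms. -/
def homotopyRel : HomRel (DGModule A) := fun _ _ f g => Homotopic f g

lemma Homotopic.refl {M N : DGModule A} (f : M ⟶ N) : Homotopic f f :=
  ⟨fun _ => 0, by simp, by simp⟩

lemma Homotopic.symm {M N : DGModule A} {f g : M ⟶ N} : Homotopic f g → Homotopic g f := by
  rintro ⟨s, hs, h⟩
  refine ⟨fun hi => -s hi, fun h₁ h₂ h₃ h₄ m a => ?_, fun h₁ h₂ m => ?_⟩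
  · simp [hs h₁ h₂ h₃ h₄]
  · rw [← neg_sub, h h₁ h₂]
    simp [add_comm]

lemma Homotopic.trans {M N : DGModule A} {f g k : M ⟶ N} :
    Homotopic f g → Homotopic g k → Homotopic f k := by
  rintro ⟨s, hs, h⟩ ⟨s', hs', h'⟩
  refine ⟨fun hi => s hi + s' hi, fun h₁ h₂ h₃ h₄ m a => ?_, fun h₁ h₂ m => ?_⟩
  · simp [hs h₁ h₂ h₃ h₄, hs' h₁ h₂ h₃ h₄]
  · rw [← sub_add_sub_cancel _ (g.f _ m), h h₁ h₂, h' h₁ h₂]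
    simp only [LinearMap.add_apply, map_add]
    abel

instance : Congruence (homotopyRel A) where
  equivalence := ⟨Homotopic.refl, Homotopic.symm, Homotopic.trans⟩
  comp_left := by
    rintro M N P f g g' ⟨s, hs, h⟩
    refine ⟨fun hi => (s hi).comp (f.f _), fun h₁ h₂ h₃ h₄ m a => ?_, fun h₁ h₂ m => ?_⟩
    · simp [f.map_act h₁, hs h₁ h₂ h₃ h₄]
    · simp [h h₁ h₂, f.map_d]
  comp_right := by
    rintro M N P f f' g ⟨s, hs, h⟩
    refine ⟨fun hi => (g.f _).comp (s hi), fun h₁ h₂ h₃ h₄ m a => ?_, fun h₁ h₂ m => ?_⟩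
    · simp [g.map_act h₄, hs h₁ h₂ h₃ h₄]
    · rw [comp_f, comp_f, ← map_sub, h h₁ h₂]
      simp [g.map_d]

instance : (homotopyRel A).IsCompatibleWithShift ℤ where
  condition := by
    rintro n M N f g ⟨s, hs, h⟩
    refine ⟨fun {i j} hi => (n.negOnePow : ℤ) • s (show j + n + 1 = i + n by omega),
      fun {i j k i' k'} h₁ h₂ h₃ h₄ (m : M.X (i + n)) a => ?_,
      fun {i j k} h₁ h₂ (m : M.X (i + n)) => ?_⟩
    · change (n.negOnePow : ℤ) • s _ (M.act _ m a) = N.act _ ((n.negOnePow : ℤ) • s _ m) a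
      rw [hs (show i + n + j = k + n by omega) (show i' + n + 1 = i + n by omega)
        (show k' + n + 1 = k + n by omega) (show i' + n + j = k' + n by omega),
        map_zsmul, LinearMap.smul_apply]
    · change f.f (i + n) m - g.f (i + n) m =
        (n.negOnePow : ℤ) • N.d _ ((n.negOnePow : ℤ) • s _ m) +
          (n.negOnePow : ℤ) • s _ ((n.negOnePow : ℤ) • M.d _ m)
      rw [h (show j + n + 1 = i + n by omega) (show i + n + 1 = k + n by omega), map_zsmul,
        map_zsmul, smul_smul, smul_smul, ← Units.val_mul]
      simp only [Int.units_mul_self, Units.val_one, one_smul]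
      rfl

variable (A) in
/-- The homotopy category `H(A)` of DG `A`-modules. -/
abbrev HomotopyCategory := Quotient (homotopyRel A)

variable (A) in
/-- Cohomology of degree `i` as a functor. -/
def cohomologyFunctor (i : ℤ) : DGModule A ⥤ ModuleCat.{w} K where
  obj M := ModuleCat.of K (M.cohomology i)
  map f := ModuleCat.ofHom (cohomologyMap f i)
  map_id M := by
    ext m
    rfl
  map_comp f g := by
    ext m
    rfl

lemma cohomologyMap_eq_of_homotopic {M N : DGModule A} {f g : M ⟶ N} (h : Homotopic f g) (i : ℤ) :
    cohomologyMap f i = cohomologyMap g i := by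
  obtain ⟨s, -, h⟩ := h
  ext m
  obtain ⟨m, hm⟩ := m
  refine (Submodule.Quotient.eq _).2 ⟨s (sub_add_cancel i 1) m, ?_⟩
  have hm' : M.d (rfl : i + 1 = i + 1) m = 0 := hm
  have := h (sub_add_cancel i 1) rfl m
  rw [hm', map_zero, add_zero] at this
  exact this.symm

variable (A) in
/-- Cohomology of degree `i` on the homotopy category. -/
def homotopyCohomologyFunctor (i : ℤ) : HomotopyCategory A ⥤ ModuleCat.{w} K :=
  CategoryTheory.Quotient.lift _ (cohomologyFunctor A i) fun _ _ _ _ h =>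
    congrArg ModuleCat.ofHom (cohomologyMap_eq_of_homotopic h i)

variable (A) in
/-- Quasi-isomorphisms in the homotopy category. -/
def homotopyQuasiIso : MorphismProperty (HomotopyCategory A) := fun _ _ f =>
  ∀ i, IsIso ((homotopyCohomologyFunctor A i).map f)

instance : (homotopyQuasiIso A).RespectsIso :=
  MorphismProperty.RespectsIso.mk _
    (fun e f hf i => by
      have := hf i
      rw [Functor.map_comp]
      infer_instance)
    (fun e f hf i => by
      have := hf i
      rw [Functor.map_comp]
      infer_instance)

lemma homotopyQuasiIso_iff {M N : DGModule A} (f : M ⟶ N) :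
    homotopyQuasiIso A ((Quotient.functor (homotopyRel A)).map f) ↔ quasiIso A f :=
  forall_congr' fun i =>
    ConcreteCategory.isIso_iff_bijective (ModuleCat.ofHom (cohomologyMap f i))

instance : (homotopyQuasiIso A).IsCompatibleWithShift ℤ where
  condition n := by
    ext M N f
    obtain ⟨f, rfl⟩ := (Quotient.functor (homotopyRel A)).map_surjective f
    rw [MorphismProperty.inverseImage_iff, homotopyQuasiIso_iff,
      ← MorphismProperty.IsCompatibleWithShift.iff (quasiIso A) f n, ← homotopyQuasiIso_iff]
    exact ((homotopyQuasiIso A).arrow_mk_iso_iff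
      (Arrow.isoMk (((Quotient.functor (homotopyRel A)).commShiftIso n).app _)
        (((Quotient.functor (homotopyRel A)).commShiftIso n).app _)
        (((Quotient.functor (homotopyRel A)).commShiftIso n).hom.naturality f).symm)).symm

end DGModule

variable (A : DGAlgebra.{v, w} K)

/-- The derived category `D(A)`: the localization of the homotopy category of DG `A`-modules at
the quasi-isomorphisms. It carries the induced shift by `ℤ`. -/
abbrev DerivedCategory := (DGModule.homotopyQuasiIso A).Localization

namespace DerivedCategory

/-- The localization functor from DG `A`-modules to `D(A)`. -/
noncomputable def Q : DGModule A ⥤ DerivedCategory A :=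
  Quotient.functor (DGModule.homotopyRel A) ⋙ (DGModule.homotopyQuasiIso A).Q

noncomputable instance : (Q A).CommShift ℤ :=
  inferInstanceAs ((Quotient.functor (DGModule.homotopyRel A) ⋙
    (DGModule.homotopyQuasiIso A).Q).CommShift ℤ)

/-- The exact triangles of `D(A)`: those isomorphic in `D(A)` to the image of a cofibre sequence
`M → N → C_f → Σ M`. -/
def distinguishedTriangles : Set (Pretriangulated.Triangle (DerivedCategory A)) :=
  {T | ∃ (M N : DGModule A) (f : M ⟶ N),
    Nonempty (T ≅ (Q A).mapTriangle.obj (DGModule.coneTriangle f))}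

end DerivedCategory

end Modules

/-! ### Thickenings and levels -/

section Level

variable {T : Type*} [Category T] [HasShift T ℤ]

/-- The first thickening of `C`: the smallest strict full subcategory that contains `C` and is
closed under finite coproducts, retracts and all shifts. -/
def thick₁ (C : T) : ObjectProperty T := fun M =>
  ∀ P : ObjectProperty T, P.IsClosedUnderIsomorphisms → P.IsClosedUnderFiniteCoproducts →
    P.IsStableUnderRetracts → P.IsStableUnderShift ℤ → P C → P M

/-- The `n`th thickening of `C`, where `Δ` is the class of exact triangles of `T`. For `n ≥ 2` it is
the smallest strict full subcategory that is closed under retracts and contains every `M` that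
admits an exact triangle `M₁ → M → M₂ → Σ M₁` with `M₁` in the `(n - 1)`st and `M₂` in the first
thickening. -/
def thick (Δ : Set (Pretriangulated.Triangle T)) (C : T) : ℕ → ObjectProperty T
  | 0 => fun M => Limits.IsZero M
  | 1 => thick₁ C
  | n + 2 => fun M => ∀ P : ObjectProperty T, P.IsClosedUnderIsomorphisms →
      P.IsStableUnderRetracts →
      (∀ t ∈ Δ, thick Δ C (n + 1) t.obj₁ → thick₁ C t.obj₃ → P t.obj₂) → P M

/-- The `C`-level of `M`: the infimum of the `n` such that `M` lies in the `n`th thickening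
of `C`; it is `⊤` if there is no such `n`. -/
noncomputable def level (Δ : Set (Pretriangulated.Triangle T)) (C M : T) : ℕ∞ :=
  ⨅ (n : ℕ) (_ : thick Δ C n M), (n : ℕ∞)

end Level

/-! ### Weak homotopy equivalences -/

section Spaces

variable {X Y : Type u} [TopologicalSpace X] [TopologicalSpace Y]

/-- Composition of a generalized loop with a continuous map. -/
def genLoopMap (f : C(X, Y)) {N : Type*} {x : X} (γ : GenLoop N X x) : GenLoop N Y (f x) :=
  ⟨f.comp γ.1, fun t ht => congrArg f (γ.2 t ht)⟩

/-- The map `π_N(X, x) → π_N(Y, f x)` induced by `f`. -/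
def homotopyGroupMap (f : C(X, Y)) (N : Type*) (x : X) :
    HomotopyGroup N X x → HomotopyGroup N Y (f x) :=
  Quotient.map (genLoopMap f) fun _ _ h => h.comp_continuousMap f

/-- The map induced by `f` on sets of path components. -/
def zerothHomotopyMap (f : C(X, Y)) : ZerothHomotopy X → ZerothHomotopy Y :=
  Quotient.map f fun _ _ h => h.map f.continuous

/-- `f` is a weak homotopy equivalence: it induces a bijection on path components and, for all
`n ≥ 1` and all base points, a bijection on `π_n`. -/
def IsWeakHomotopyEquiv (f : C(X, Y)) : Prop :=
  Function.Bijective (zerothHomotopyMap f) ∧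
    ∀ (n : ℕ) (x : X), Function.Bijective (homotopyGroupMap f (Fin (n + 1)) x)

end Spaces

/-! ### The level of a map -/

section LevelOfMap

variable (K : Type v) [Field K]

/-- The singular cochain algebra `C^*(X; K)`. -/
noncomputable abbrev singularCochains (X : Type u) [TopologicalSpace X] :
    DGAlgebra.{v, max u v} K :=
  cochainAlgebra K (TopCat.toSSet.obj (TopCat.of X))

variable {X Y : Type u} [TopologicalSpace X] [TopologicalSpace Y]

/-- The morphism of DG algebras `α^* : C^*(X; K) → C^*(Y; K)` induced by `α : Y → X`. -/
noncomputable def singularCochainsMap (α : C(Y, X)) :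
    (singularCochains K X).Hom (singularCochains K Y) :=
  cochainMap K (TopCat.toSSet.map (TopCat.ofHom α))

/-- The level of a map `α : Y → X`: the `C^*(X; K)`-level of `C^*(Y; K)`, regarded as a DG
`C^*(X; K)`-module via `α^*`, in the derived category `D(C^*(X; K))`. -/
noncomputable def levelOver (α : C(Y, X)) : ℕ∞ :=
  level (DerivedCategory.distinguishedTriangles (singularCochains K X))
    ((DerivedCategory.Q _).obj (singularCochains K X).regular)
    ((DerivedCategory.Q _).obj (singularCochainsMap K α).restrict)

end LevelOfMap

end DGLevel

set_option linter.unusedSectionVars false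

/-! The level is an isomorphism invariant in the derived category, because every thickening is
closed under isomorphism (`level_eq_of_iso`). A map of spaces over `X` that induces isomorphisms on
singular cohomology gives a quasi-isomorphism of DG modules over the cochains of `X`, hence an
isomorphism in the derived category and equal levels (`levelOver_eq_of_isCohomologyIso`). Two cases
are needed. If `α` and `β.comp f` are homotopic, the homotopy makes the cylinder on `Y` a space over
`X` whose two ends carry the two maps, and both end inclusions are homotopy equivalences
(`levelOver_eq_of_homotopic`). The map `f` itself lies over `X`, so it remains to see that a weak
homotopy equivalence is an isomorphism on singular cohomology
(`IsWeakHomotopyEquiv.isCohomologyIso`).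

For this, factor `f` through its mapping path space as a homotopy equivalence followed by the end
point map. Bijectivity on path components and homotopy groups says that `f` solves lifting problems
on balls up to homotopy relative to the sphere (`IsWeakHomotopyEquiv.liftsBall`, by way of
`liftsBall_prod`). In the mapping path space that homotopy becomes the path coordinate, so the end
point map lifts strictly, on balls and hence on simplices. Its singular simplicial map therefore has
the right lifting property against boundary inclusions (`IsWeakHomotopyEquiv.rlp_target`). Such a
map has a section that is also an inverse up to simplicial homotopy (`exists_homotopy_of_rlp`), and
simplicially homotopic maps agree on the cohomology of cochains (`exists_d_eq_sub_of_homotopy`). -/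

namespace DGLevel

/-! ### Lifting problems on balls -/

section Balls

variable {E W : Type*} [NormedAddCommGroup E] [NormedSpace ℝ E] [TopologicalSpace W]

/-- The radial retraction of `E` onto the unit ball. -/
noncomputable def ballRetract (x : E) : E := (max ‖x‖ 1)⁻¹ • x

@[fun_prop]
lemma continuous_ballRetract : Continuous (ballRetract : E → E) := by
  refine Continuous.smul (Continuous.inv₀ (by fun_prop) fun x => ?_) continuous_id
  positivity

lemma ballRetract_of_le {x : E} (hx : ‖x‖ ≤ 1) : ballRetract x = x := by
  simp [ballRetract, max_eq_right hx]

lemma norm_ballRetract (x : E) : ‖ballRetract x‖ = min ‖x‖ 1 := by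
  rw [ballRetract, norm_smul, norm_inv, Real.norm_eq_abs, abs_of_pos (by positivity)]
  rcases le_total ‖x‖ 1 with h | h
  · rw [max_eq_right h, min_eq_left h]; simp
  · rw [max_eq_left h, min_eq_right h, inv_mul_cancel₀ (by positivity)]

lemma norm_ballRetract_le (x : E) : ‖ballRetract x‖ ≤ 1 :=
  (norm_ballRetract x).le.trans (min_le_right _ _)

/-- Two maps are homotopic on the closed unit ball relative to the unit sphere. -/
def BallHomotopic (u v : E → W) : Prop :=
  ∃ G : E × ℝ → W, Continuous G ∧ (∀ x, ‖x‖ ≤ 1 → G (x, 0) = u x) ∧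
    (∀ x, ‖x‖ ≤ 1 → G (x, 1) = v x) ∧
    ∀ x t, ‖x‖ = 1 → 0 ≤ t → t ≤ 1 → G (x, t) = u x

lemma BallHomotopic.trans {u v w : E → W} (h₁ : BallHomotopic u v) (h₂ : BallHomotopic v w) :
    BallHomotopic u w := by
  obtain ⟨G, hG, G0, G1, GS⟩ := h₁
  obtain ⟨H, hH, H0, H1, HS⟩ := h₂
  have huv : ∀ x, ‖x‖ = 1 → v x = u x := fun x hx => by
    rw [← G1 x hx.le, GS x 1 hx zero_le_one le_rfl]
  -- The two homotopies are known to match only over the ball. Retracting the first variable makes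
  -- the formulas agree at time `1 / 2` over all of `E`, as continuity requires.
  refine ⟨fun z => if z.2 ≤ 1 / 2 then G (ballRetract z.1, 2 * z.2) else H (ballRetract z.1, 2 * z.2 - 1),
    ?_, fun x hx => ?_, fun x hx => ?_, fun x t hx h0 h1 => ?_⟩
  · refine continuous_if_le (by fun_prop) (by fun_prop) (by fun_prop) (by fun_prop) ?_
    rintro ⟨x, t⟩ rfl
    have : (2 : ℝ) * (1 / 2) = 1 := by norm_num
    simp only [this, sub_self]
    rw [G1 _ (norm_ballRetract_le x), H0 _ (norm_ballRetract_le x)]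
  · simp [ballRetract_of_le hx, G0 x hx]
  · norm_num [ballRetract_of_le hx, H1 x hx]
  · simp only [ballRetract_of_le hx.le]
    split_ifs with h
    · exact GS x _ hx (by linarith) (by linarith)
    · rw [HS x _ hx (by linarith) (by linarith), huv x hx]

/-- The map that is `A` on the unit ball and `q` on a collar of width one around it. -/
noncomputable def collar (A : E → W) (q : E × ℝ → W) (p : E) : W :=
  if ‖p‖ ≤ 1 then A p else q (‖p‖⁻¹ • p, min (‖p‖ - 1) 1)

lemma collar_of_le (A : E → W) (q : E × ℝ → W) {p : E} (hp : ‖p‖ ≤ 1) : collar A q p = A p :=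
  if_pos hp

lemma collar_smul {A : E → W} {q : E × ℝ → W} (h : ∀ x, ‖x‖ = 1 → A x = q (x, 0)) {x : E}
    (hx : ‖x‖ = 1) {t : ℝ} (h0 : 0 ≤ t) (h1 : t ≤ 1) :
    collar A q ((1 + t) • x) = q (x, t) := by
  have hn : ‖(1 + t) • x‖ = 1 + t := by
    rw [norm_smul, hx, Real.norm_eq_abs, abs_of_nonneg (by linarith), mul_one]
  rcases h0.eq_or_lt with rfl | h0
  · rw [collar_of_le _ _ (by rw [hn]; simp)]
    simpa using h x hx
  · rw [collar, if_neg (by rw [hn]; linarith), hn, smul_smul, inv_mul_cancel₀ (by linarith),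
      one_smul, add_sub_cancel_left, min_eq_left h1]

/-- Continuity of `q` is asked only over the sphere and the unit interval, since `q` usually comes
from data on the sphere. The parameter `τ` lets the inner map and the point vary, so that homotopies
can be built from collars. -/
lemma continuous_collar {T : Type*} [TopologicalSpace T] {A : T → E → W} {φ : T → E}
    {q : E × ℝ → W}
    (hA : Continuous fun τ => A τ (φ τ)) (hφ : Continuous φ)
    (hq : ContinuousOn q {z | ‖z.1‖ = 1 ∧ z.2 ∈ Set.Icc (0 : ℝ) 1})
    (h : ∀ τ x, ‖x‖ = 1 → A τ x = q (x, 0)) : Continuous fun τ => collar (A τ) q (φ τ) := by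
  refine continuous_if_le hφ.norm continuous_const hA.continuousOn ?_ fun τ hτ => ?_
  · refine hq.comp (ContinuousOn.prodMk (ContinuousOn.smul (ContinuousOn.inv₀ (by fun_prop) ?_)
      (by fun_prop)) (by fun_prop)) ?_
    · intro τ hτ
      have : (1 : ℝ) ≤ ‖φ τ‖ := hτ
      exact (zero_lt_one.trans_le this).ne'
    · intro τ hτ
      have h1 : (1 : ℝ) ≤ ‖φ τ‖ := hτ
      have h0 : ‖φ τ‖ ≠ 0 := (zero_lt_one.trans_le h1).ne'
      exact ⟨by simp [norm_smul, h0], le_min (by linarith) zero_le_one, min_le_right _ _⟩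
  · rw [h τ _ hτ, hτ]
    simp

lemma exists_eq_smul {x : E} {r : ℝ} (hr : 0 < r) (hx : r ≤ ‖x‖) :
    ∃ p : E, ‖p‖ = 1 ∧ x = ‖x‖ • p := by
  have h0 : ‖x‖ ≠ 0 := (hr.trans_le hx).ne'
  exact ⟨‖x‖⁻¹ • x, by simp [norm_smul, h0], by rw [smul_smul, mul_inv_cancel₀ h0, one_smul]⟩

lemma norm_two_smul (x : E) : ‖(2 : ℝ) • x‖ = 2 * ‖x‖ := by
  rw [norm_smul]; norm_num

lemma continuousOn_reverse {q : E × ℝ → W}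
    (hq : ContinuousOn q {z | ‖z.1‖ = 1 ∧ z.2 ∈ Set.Icc (0 : ℝ) 1}) :
    ContinuousOn (fun z : E × ℝ => q (z.1, 1 - z.2))
      {z | ‖z.1‖ = 1 ∧ z.2 ∈ Set.Icc (0 : ℝ) 1} :=
  hq.comp (by fun_prop) fun z hz => ⟨hz.1, by simpa using hz.2.2, by simpa using hz.2.1⟩

/-- Extendability from the sphere to the ball is invariant under homotopy. -/
lemma exists_extension_of_homotopy {q : E × ℝ → W}
    (hq : ContinuousOn q {z | ‖z.1‖ = 1 ∧ z.2 ∈ Set.Icc (0 : ℝ) 1})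
    (h : ∃ g : E → W, Continuous g ∧ ∀ x, ‖x‖ = 1 → g x = q (x, 1)) :
    ∃ g : E → W, Continuous g ∧ ∀ x, ‖x‖ = 1 → g x = q (x, 0) := by
  obtain ⟨g, hg, h⟩ := h
  have h' : ∀ x, ‖x‖ = 1 → g x = q (x, 1 - 0) := by simpa using h
  -- The ball of radius one half carries a shrunken `g`. The annulus around it runs the homotopy
  -- backwards from time `1` to time `0`.
  refine ⟨fun x => collar g (fun z => q (z.1, 1 - z.2)) ((2 : ℝ) • x),
    continuous_collar (A := fun _ => g) (by fun_prop) (by fun_prop) (continuousOn_reverse hq)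
      fun _ => h', fun x hx => ?_⟩
  have := collar_smul (q := fun z => q (z.1, 1 - z.2)) h' hx zero_le_one le_rfl
  rw [one_add_one_eq_two] at this
  simpa using this

variable {Y Z : Type*} [TopologicalSpace Y] [TopologicalSpace Z]

/-- The lifting problem for `f` given by `y` on the sphere and `s` on the ball has a solution
up to homotopy. -/
def Liftable (f : Y → Z) (y : E → Y) (s : E → Z) : Prop :=
  ∃ g : E → Y, Continuous g ∧ (∀ x, ‖x‖ = 1 → g x = y x) ∧ BallHomotopic (f ∘ g) s

/-- Solvability of lifting problems is invariant under homotopy. -/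
lemma liftable_of_homotopy {f : Y → Z} (hf : Continuous f) {y : E × ℝ → Y}
    (hy : ContinuousOn y {z | ‖z.1‖ = 1 ∧ z.2 ∈ Set.Icc (0 : ℝ) 1})
    {s : E → Z} (hs : Continuous s) (hys : ∀ x, ‖x‖ = 1 → s x = f (y (x, 0)))
    (h : ∀ s₁ : E → Z, Continuous s₁ → (∀ x, ‖x‖ = 1 → s₁ x = f (y (x, 1))) →
      Liftable f (fun x => y (x, 1)) s₁) : Liftable f (fun x => y (x, 0)) s := by
  let C : E → Z := collar s fun z => f (y z)
  have hC : Continuous C :=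
    continuous_collar (A := fun _ => s) hs continuous_id (hf.comp_continuousOn hy) fun _ => hys
  have C1 : ∀ (x : E) (t : ℝ), ‖x‖ = 1 → 0 ≤ t → t ≤ 1 → C ((1 + t : ℝ) • x) = f (y (x, t)) :=
    fun x t hx h0 h1 => collar_smul hys hx h0 h1
  have C2 : ∀ x, ‖x‖ = 1 → C ((2 : ℝ) • x) = f (y (x, 1)) := fun x hx => by
    rw [← C1 x 1 hx zero_le_one le_rfl, one_add_one_eq_two]
  obtain ⟨g, hg, hgy, G, hG, G0, G1, GS⟩ := h (fun x => C ((2 : ℝ) • x)) (by fun_prop) C2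
  have hgy' : ∀ x, ‖x‖ = 1 → g x = y (x, 1 - 0) := by simpa using hgy
  -- Clamping the time makes the boundary condition of `G` available for every real `t`, which
  -- gluing with the collar requires.
  have GS' : ∀ (t : ℝ) x, ‖x‖ = 1 → G (x, max 0 (min t 1)) = f (y (x, 1 - 0)) := fun t x hx => by
    rw [GS x _ hx (by simp) (by simp), Function.comp_apply, hgy' x hx]
  refine ⟨fun x => collar g (fun z => y (z.1, 1 - z.2)) ((2 : ℝ) • x),
    continuous_collar (A := fun _ => g) (by fun_prop) (by fun_prop) (continuousOn_reverse hy)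
      fun _ => hgy', fun x hx => ?_, ?_⟩
  · have := collar_smul (q := fun z => y (z.1, 1 - z.2)) hgy' hx zero_le_one le_rfl
    rw [one_add_one_eq_two] at this
    simpa using this
  -- `ρ` is multiplication by `4` on the ball of radius one half, so it covers the ball of radius
  -- `2`. On the annulus it keeps the direction and sends radius `r` to `3 - 2r`, folding back from
  -- radius `2` to radius `1`. It fixes the unit sphere.
  let ρ : E → E := fun x => (3 * (max ‖x‖ (1 / 2))⁻¹ - 2) • x
  have hρ : Continuous ρ := by
    refine Continuous.smul (Continuous.sub (continuous_const.mul
      (Continuous.inv₀ (by fun_prop) fun x => ?_)) continuous_const) continuous_id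
    positivity
  have hρS : ∀ x, ‖x‖ = 1 → ρ x = x := fun x hx => by
    have : (3 : ℝ) - 2 = 1 := by norm_num
    norm_num [ρ, hx, this]
  have key : ∀ x, ‖x‖ ≤ 1 →
      collar (fun p => G (p, 1)) (fun z => f (y (z.1, 1 - z.2))) ((2 : ℝ) • x) = C (ρ x) := by
    intro x hx
    rcases le_total ‖x‖ (1 / 2) with hx' | hx'
    · have hn : ‖(2 : ℝ) • x‖ ≤ 1 := by rw [norm_two_smul]; linarith
      rw [collar_of_le _ _ hn, G1 _ hn]
      change C ((2 : ℝ) • (2 : ℝ) • x) = _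
      rw [smul_smul]
      simp only [ρ, max_eq_right hx']
      norm_num
    · obtain ⟨p, hp, hxp⟩ := exists_eq_smul (by norm_num) hx'
      have e1 : (2 : ℝ) • x = (1 + (2 * ‖x‖ - 1)) • p := by
        conv_lhs => rw [hxp, smul_smul]
        ring_nf
      have e2 : ρ x = (1 + (2 - 2 * ‖x‖)) • p := by
        have : ‖x‖ ≠ 0 := by positivity
        simp only [ρ, max_eq_left hx']
        conv_lhs => rw [hxp, smul_smul, ← hxp]
        congr 1
        field_simp
        ring
      rw [e1, e2, C1 p _ hp (by linarith) (by linarith),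
        collar_smul (fun x hx => ?_) hp (by linarith) (by linarith)]
      · congr 3
        ring
      · simpa using GS' 1 x hx
  -- First `G` acts on the inner ball while the annulus stays fixed; by `key` this ends at `C ∘ ρ`.
  -- Then the straight line from `ρ` to the identity, inside the domain of `C`, ends at `C`, which
  -- is `s` on the ball.
  refine BallHomotopic.trans (v := fun x => C (ρ x))
    ⟨fun z => collar (fun p => G (p, max 0 (min z.2 1))) (fun z => f (y (z.1, 1 - z.2)))
      ((2 : ℝ) • z.1), ?_, fun x hx => ?_, fun x hx => ?_, fun x t hx h0 h1 => ?_⟩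
    ⟨fun z => C ((1 - z.2) • ρ z.1 + z.2 • z.1), by fun_prop, fun x hx => by simp,
      fun x hx => ?_, fun x t hx _ _ => ?_⟩
  · exact continuous_collar (A := fun z : E × ℝ => fun p => G (p, max 0 (min z.2 1)))
      (by fun_prop) (by fun_prop) (hf.comp_continuousOn (continuousOn_reverse hy))
      fun z x hx => GS' _ x hx
  · simp only [Function.comp_apply]
    by_cases hn : ‖(2 : ℝ) • x‖ ≤ 1
    · rw [collar_of_le _ _ hn, collar_of_le _ _ hn]
      simpa using G0 _ hn
    · rw [collar, collar, if_neg hn, if_neg hn]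
  · simp [← key x hx]
  · have e1 : (2 : ℝ) • x = (1 + 1 : ℝ) • x := by norm_num
    simp only [Function.comp_apply]
    rw [e1, collar_smul (fun x hx => ?_) hx zero_le_one le_rfl,
      collar_smul (fun x hx => ?_) hx zero_le_one le_rfl]
    · exact hgy' x hx
    · exact GS' _ x hx
  · simp [C, collar_of_le _ _ hx]
  · simp only [hρS x hx]
    rw [← add_smul]
    simp

/-- `f` lifts on the ball of `E`. -/
def LiftsBall (f : Y → Z) (E : Type*) [NormedAddCommGroup E] [NormedSpace ℝ E] : Prop :=
  ∀ (y : E → Y) (s : E → Z), ContinuousOn y {x | ‖x‖ = 1} → Continuous s →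
    (∀ x, ‖x‖ = 1 → s x = f (y x)) → Liftable f y s

/-- Injectivity on spheroids. -/
def InjBall (f : Y → Z) (E : Type*) [NormedAddCommGroup E] [NormedSpace ℝ E] : Prop :=
  ∀ (y₀ : Y) (g : E → Y), Continuous g → (∀ x, ‖x‖ = 1 → g x = y₀) →
    BallHomotopic (f ∘ g) (fun _ => f y₀) → BallHomotopic g (fun _ => y₀)

/-- Surjectivity on spheroids. -/
def SurjBall (f : Y → Z) (E : Type*) [NormedAddCommGroup E] [NormedSpace ℝ E] : Prop :=
  ∀ (y₀ : Y) (s : E → Z), Continuous s → (∀ x, ‖x‖ = 1 → s x = f y₀) →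
    Liftable f (fun _ => y₀) s

/-- Contracting the ball to its centre moves the boundary map `y` to the constant `g 0` and the
lifting problem to one about a spheroid, which `SurjBall` solves. -/
lemma liftable_of_extension {f : Y → Z} (hf : Continuous f) (hS : SurjBall f E) {y : E → Y}
    {s : E → Z} (hs : Continuous s) (hys : ∀ x, ‖x‖ = 1 → s x = f (y x))
    (h : ∃ g : E → Y, Continuous g ∧ ∀ x, ‖x‖ = 1 → g x = y x) : Liftable f y s := by
  obtain ⟨g, hg, hgy⟩ := h
  have := liftable_of_homotopy hf (y := fun z => g ((1 - z.2) • z.1)) (by fun_prop) hs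
    (fun x hx => by simp [hys x hx, hgy x hx])
    (fun s₁ hs₁ h₁ => by simpa using hS (g 0) s₁ hs₁ (by simpa using h₁))
  obtain ⟨g', hg', hgy', H⟩ := this
  exact ⟨g', hg', fun x hx => by simpa [hgy x hx] using hgy' x hx, H⟩

lemma norm_prod_eq_one {z : E × ℝ} : ‖z‖ = 1 ↔
    (‖z.1‖ = 1 ∧ -1 ≤ z.2 ∧ z.2 ≤ 1) ∨ (‖z.1‖ ≤ 1 ∧ (z.2 = 1 ∨ z.2 = -1)) := by
  rw [Prod.norm_def, Real.norm_eq_abs]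
  constructor
  · intro h
    rcases max_choice ‖z.1‖ |z.2| with h' | h' <;> rw [h'] at h
    · left
      have := le_max_right ‖z.1‖ |z.2|
      rw [h', h] at this
      exact ⟨h, (abs_le.1 this).1, (abs_le.1 this).2⟩
    · right
      have := le_max_left ‖z.1‖ |z.2|
      rw [h', h] at this
      exact ⟨this, eq_or_eq_neg_of_abs_eq h⟩
  · rintro (⟨h, h1, h2⟩ | ⟨h, h' | h'⟩)
    · rw [h, max_eq_left (abs_le.2 ⟨h1, h2⟩)]
    · rw [h', abs_one, max_eq_right h]
    · rw [h', abs_neg, abs_one, max_eq_right h]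

/-- In the sup norm the ball of `E × ℝ` is a cylinder with two lids. It suffices to extend `y` from
the boundary of this cylinder to its interior. The map `y` is deformed until it is constant except
on the top lid, where it is a spheroid on the ball of `E`. The map `s` shows that the image of this
spheroid under `f` is null-homotopic, and `InjBall` lifts the null homotopy. -/
lemma liftsBall_prod {f : Y → Z} (hf : Continuous f) (hI : InjBall f E)
    (hS : SurjBall f (E × ℝ)) : LiftsBall f (E × ℝ) := by
  intro y s hy hs hys
  refine liftable_of_extension hf hS hs hys ?_
  -- A deformation of the boundary of the cylinder in itself: the lids are stretched by `1 + t`, and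
  -- whatever leaves the top lid slides down the side. The factor `2` is the height of the cylinder,
  -- so at time `1` the whole side has reached the bottom rim.
  let Φ : (E × ℝ) × ℝ → E × ℝ := fun z =>
    (ballRetract ((1 + z.2) • z.1.1), max (-1) (z.1.2 - 2 * max 0 ((1 + z.2) * ‖z.1.1‖ - 1)))
  have hΦ : Continuous Φ := by fun_prop
  have ΦS : ∀ z : (E × ℝ) × ℝ, ‖z.1‖ = 1 ∧ z.2 ∈ Set.Icc (0 : ℝ) 1 → ‖Φ z‖ = 1 := by
    rintro ⟨⟨x, σ⟩, t⟩ ⟨h, h0, h1⟩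
    have hn : ‖(1 + t) • x‖ = (1 + t) * ‖x‖ := by
      rw [norm_smul, Real.norm_eq_abs, abs_of_nonneg (by dsimp at h0; linarith)]
    rw [norm_prod_eq_one] at h ⊢
    dsimp at h h0 h1 ⊢
    simp only [Φ, norm_ballRetract, hn]
    have hp := mul_nonneg h0 (norm_nonneg x)
    rcases h with ⟨hx, h2, h3⟩ | ⟨hx, rfl | rfl⟩
    · left
      rw [hx, min_eq_right (by linarith)]
      have := le_max_left 0 ((1 + t) * 1 - 1)
      exact ⟨rfl, le_max_left _ _, max_le (by norm_num) (by linarith)⟩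
    · rcases le_total ((1 + t) * ‖x‖) 1 with h' | h'
      · right
        rw [max_eq_left (a := (0 : ℝ)) (by linarith)]
        norm_num
      · left
        rw [min_eq_right h']
        have := le_max_left 0 ((1 + t) * ‖x‖ - 1)
        exact ⟨rfl, le_max_left _ _, max_le (by norm_num) (by linarith)⟩
    · right
      have := le_max_left 0 ((1 + t) * ‖x‖ - 1)
      exact ⟨min_le_right _ _, Or.inr (max_eq_left (by linarith))⟩
  have hqA : ContinuousOn (fun z => y (Φ z)) {z | ‖z.1‖ = 1 ∧ z.2 ∈ Set.Icc (0 : ℝ) 1} :=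
    hy.comp hΦ.continuousOn ΦS
  have Φ0 : ∀ z : E × ℝ, ‖z‖ = 1 → Φ (z, 0) = z := by
    rintro ⟨x, σ⟩ h
    rw [norm_prod_eq_one] at h
    dsimp at h
    have h1 : ‖x‖ ≤ 1 := by rcases h with h | h <;> linarith [h.1]
    have h2 : -1 ≤ σ := by rcases h with h | ⟨_, h | h⟩ <;> linarith
    simp [Φ, ballRetract_of_le h1, h1, h2]
  -- After the first deformation the map on the side and the bottom is `v x`, independent of the
  -- height. Since `v` is defined on the whole ball, it can be contracted to `v 0`.
  let v : E → Y := fun x => y (ballRetract ((2 : ℝ) • x), -1)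
  have hv : Continuous v := hy.comp_continuous (by fun_prop) fun x =>
    norm_prod_eq_one.2 (Or.inr ⟨norm_ballRetract_le _, Or.inr rfl⟩)
  have hv1 : ∀ (x : E) (σ : ℝ), ‖(x, σ)‖ = 1 → ‖x‖ = 1 ∨ σ ≤ 0 → y (Φ ((x, σ), 1)) = v x := by
    intro x σ h h'
    have : σ - 2 * max 0 ((1 + 1) * ‖x‖ - 1) ≤ -1 := by
      have h0 := le_max_left 0 ((1 + 1) * ‖x‖ - 1)
      have h1 := le_max_right 0 ((1 + 1) * ‖x‖ - 1)
      rw [norm_prod_eq_one] at h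
      dsimp at h
      rcases h with ⟨h, h2, h3⟩ | ⟨h, h2 | h2⟩
      · linarith
      · rcases h' with h' | h' <;> linarith
      · linarith
    simp only [Φ, v, max_eq_left this]
    rw [one_add_one_eq_two]
  let w : E → Y := fun x => y (Φ ((ballRetract x, 1), 1))
  have hw : Continuous w := hqA.comp_continuous (by fun_prop) fun x =>
    ⟨norm_prod_eq_one.2 (Or.inr ⟨norm_ballRetract_le _, Or.inl rfl⟩), by simp⟩
  have hwv : ∀ x, ‖x‖ = 1 → w x = v ((1 - 0 : ℝ) • x) := fun x hx => by
    simp only [w, ballRetract_of_le hx.le, sub_zero, one_smul]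
    exact hv1 _ _ (norm_prod_eq_one.2 (Or.inr ⟨hx.le, Or.inl rfl⟩)) (Or.inl hx)
  let C : E → Y := collar w fun z => v ((1 - z.2) • z.1)
  have hC : Continuous C :=
    continuous_collar (A := fun _ => w) hw continuous_id (by fun_prop) fun _ => hwv
  have C1 : ∀ (x : E) (t : ℝ), ‖x‖ = 1 → 0 ≤ t → t ≤ 1 → C ((1 + t : ℝ) • x) = v ((1 - t : ℝ) • x) :=
    fun x t hx h0 h1 => collar_smul (q := fun z : E × ℝ => v ((1 - z.2) • z.1)) hwv hx h0 h1
  -- The second deformation contracts `v` to `v 0` on the lower half of the boundary. On the upper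
  -- half the radial contraction of `v`, attached to `w` as a collar, is pulled into the top lid.
  -- The two closed halves meet only in the side, where `C1` makes the formulas agree.
  let qB : (E × ℝ) × ℝ → Y := fun z =>
    if 0 ≤ z.1.2 then C ((1 + z.2) • z.1.1) else v ((1 - z.2) • z.1.1)
  have hqB : ContinuousOn qB {z | ‖z.1‖ = 1 ∧ z.2 ∈ Set.Icc (0 : ℝ) 1} := by
    have hcl : IsClosed {z : (E × ℝ) × ℝ | ‖z.1‖ = 1 ∧ z.2 ∈ Set.Icc (0 : ℝ) 1} :=
      (isClosed_eq (by fun_prop) continuous_const).inter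
        (isClosed_Icc.preimage continuous_snd)
    have hU : {z : (E × ℝ) × ℝ | ‖z.1‖ = 1 ∧ z.2 ∈ Set.Icc (0 : ℝ) 1} =
        ({z | ‖z.1‖ = 1 ∧ z.2 ∈ Set.Icc (0 : ℝ) 1} ∩ {z | 0 ≤ z.1.2}) ∪
        ({z | ‖z.1‖ = 1 ∧ z.2 ∈ Set.Icc (0 : ℝ) 1} ∩ {z | z.1.2 ≤ 0}) := by
      rw [← Set.inter_union_distrib_left]
      exact (Set.inter_eq_left.2 fun z _ => le_total 0 z.1.2).symm
    rw [hU]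
    refine ContinuousOn.union_of_isClosed ?_ ?_
      (hcl.inter (isClosed_le (by fun_prop) (by fun_prop)))
      (hcl.inter (isClosed_le (by fun_prop) (by fun_prop)))
    · refine ContinuousOn.congr (f := fun z => C ((1 + z.2) • z.1.1)) (by fun_prop) ?_
      rintro z ⟨_, hz⟩
      exact if_pos hz
    · refine ContinuousOn.congr (f := fun z => v ((1 - z.2) • z.1.1)) (by fun_prop) ?_
      rintro ⟨⟨x, σ⟩, t⟩ ⟨⟨h, h0, h1⟩, hσ⟩
      simp only [qB]
      split_ifs with h'
      · rw [norm_prod_eq_one] at h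
        dsimp at h h' hσ
        exact C1 _ _ (by rcases h with h | ⟨_, h | h⟩ <;> [exact h.1; linarith; linarith]) h0 h1
      · rfl
  have qB0 : ∀ z, ‖z‖ = 1 → qB (z, 0) = y (Φ (z, 1)) := by
    rintro ⟨x, σ⟩ h
    have h2 := norm_prod_eq_one.1 h
    dsimp at h2
    have hx : ‖x‖ ≤ 1 := by rcases h2 with h | h <;> linarith [h.1]
    simp only [qB, add_zero, one_smul, sub_zero]
    split_ifs with hσ
    · simp only [C, collar_of_le _ _ hx, w, ballRetract_of_le hx]
      rcases h2 with ⟨hx', -, -⟩ | ⟨-, rfl | rfl⟩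
      · rw [hv1 _ _ h (Or.inl hx'),
          hv1 _ _ (norm_prod_eq_one.2 (Or.inr ⟨hx, Or.inl rfl⟩)) (Or.inl hx')]
      · rfl
      · norm_num at hσ
    · rw [hv1 _ _ h (Or.inr (not_le.1 hσ).le)]
  let w₂ : E → Y := fun x => C ((2 : ℝ) • x)
  have hw₂ : ∀ x, ‖x‖ = 1 → w₂ x = v 0 := fun x hx => by
    have := C1 x 1 hx zero_le_one le_rfl
    simpa [one_add_one_eq_two] using this
  have qB1 : ∀ x σ, ‖(x, σ)‖ = 1 → qB ((x, σ), 1) = if σ = 1 then w₂ x else v 0 := by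
    intro x σ h
    rw [norm_prod_eq_one] at h
    dsimp at h
    simp only [qB, one_add_one_eq_two, sub_self, zero_smul]
    split_ifs with h1 h2 h3
    · rfl
    · rcases h with h | ⟨_, h | h⟩
      · exact hw₂ x h.1
      · exact absurd h h2
      · exact absurd h1 (by rw [h]; norm_num)
    · exact absurd h1 (by rw [h3]; norm_num)
    · rfl
  -- Extendability of `f ∘ y` is carried forward through both deformations, hence the reversed
  -- homotopies.
  obtain ⟨s₁, hs₁, hsy₁⟩ := exists_extension_of_homotopy
    (continuousOn_reverse (hf.comp_continuousOn hqA))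
    ⟨s, hs, fun x hx => by simp [Φ0 x hx, hys x hx]⟩
  obtain ⟨s₂, hs₂, hsy₂⟩ := exists_extension_of_homotopy
    (continuousOn_reverse (hf.comp_continuousOn hqB))
    ⟨s₁, hs₁, fun x hx => by simpa [qB0 x hx] using hsy₁ x hx⟩
  replace hsy₂ : ∀ z, ‖z‖ = 1 → s₂ z = f (qB (z, 1)) := by simpa using hsy₂
  have hside : ∀ (x : E) (t : ℝ), ‖x‖ = 1 → 0 ≤ t → t ≤ 1 → ‖(x, 1 - 2 * t)‖ = 1 :=
    fun x t hx h0 h1 => norm_prod_eq_one.2 (Or.inl ⟨hx, by dsimp; linarith, by dsimp; linarith⟩)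
  -- The horizontal slices of `s₂` from the top lid to the bottom lid form the null homotopy. It is
  -- relative to the sphere because the deformed map is constant on the side.
  have hnull : BallHomotopic (f ∘ w₂) (fun _ => f (v 0)) := by
    refine ⟨fun z => s₂ (z.1, 1 - 2 * z.2), by fun_prop, fun x hx => ?_, fun x hx => ?_,
      fun x t hx h0 h1 => ?_⟩
    · dsimp
      rw [mul_zero, sub_zero, hsy₂ _ (norm_prod_eq_one.2 (Or.inr ⟨hx, Or.inl rfl⟩)),
        qB1 _ _ (norm_prod_eq_one.2 (Or.inr ⟨hx, Or.inl rfl⟩)), if_pos rfl]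
    · dsimp
      have e : (1 - 2 * 1 : ℝ) = -1 := by norm_num
      rw [e, hsy₂ _ (norm_prod_eq_one.2 (Or.inr ⟨hx, Or.inr rfl⟩)),
        qB1 _ _ (norm_prod_eq_one.2 (Or.inr ⟨hx, Or.inr rfl⟩)), if_neg (by norm_num)]
    · dsimp
      rw [hsy₂ _ (hside x t hx h0 h1), qB1 _ _ (hside x t hx h0 h1), hw₂ x hx, ite_self]
  obtain ⟨N, hN, N0, N1, NS⟩ := hI (v 0) w₂ (by fun_prop) hw₂ hnull
  -- Stacked over the height, with time `(1 - σ) / 2`, the null homotopy `N` fills the cylinder. The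
  -- extension is then carried back along `qB` and `qA`.
  obtain ⟨g₁, hg₁, h₁⟩ := exists_extension_of_homotopy hqB
    ⟨fun z => N (z.1, (1 - z.2) / 2), by fun_prop, by
      rintro ⟨x, σ⟩ h
      rw [qB1 _ _ h]
      rw [norm_prod_eq_one] at h
      dsimp at h ⊢
      split_ifs with h1
      · rw [h1, sub_self, zero_div]
        exact N0 x (by rcases h with h | h <;> linarith [h.1])
      · rcases h with ⟨h, h2, h3⟩ | ⟨h, h2 | h2⟩
        · rw [NS _ _ h (by linarith) (by linarith), hw₂ _ h]
        · exact absurd h2 h1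
        · norm_num [h2, N1 x h]⟩
  obtain ⟨g, hg, h⟩ := exists_extension_of_homotopy hqA
    ⟨g₁, hg₁, fun x hx => by rw [h₁ x hx, qB0 x hx]⟩
  exact ⟨g, hg, fun x hx => by rw [h x hx, Φ0 x hx]⟩

/-- Lifting up to homotopy, for lifting problems that commute up to a given homotopy. -/
lemma LiftsBall.exists_path_lift {f : Y → Z} (hL : LiftsBall f E)
    {y : E → Y} {s : E → Z} {h : E × ℝ → Z} (hy : ContinuousOn y {x | ‖x‖ = 1})
    (hs : Continuous s) (hh : ContinuousOn h {z | ‖z.1‖ = 1 ∧ z.2 ∈ Set.Icc (0 : ℝ) 1})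
    (h0 : ∀ x, ‖x‖ = 1 → h (x, 0) = f (y x)) (h1 : ∀ x, ‖x‖ = 1 → h (x, 1) = s x) :
    ∃ (g : E → Y) (H : E × ℝ → Z), Continuous g ∧ Continuous H ∧ (∀ x, ‖x‖ = 1 → g x = y x) ∧
      (∀ x, ‖x‖ ≤ 1 → H (x, 0) = f (g x)) ∧ (∀ x, ‖x‖ ≤ 1 → H (x, 1) = s x) ∧
      ∀ x t, ‖x‖ = 1 → 0 ≤ t → t ≤ 1 → H (x, t) = h (x, t) := by
  have hs' : ∀ x, ‖x‖ = 1 → s x = h (x, 1 - 0) := by simpa using fun x hx => (h1 x hx).symm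
  -- The map `s` is enlarged by the reversed homotopy `h`, so that on the sphere of radius `2` it
  -- agrees with `f ∘ y` strictly and the hypothesis on `f` applies.
  let C : E → Z := collar s fun z => h (z.1, 1 - z.2)
  have hC : Continuous C := continuous_collar (A := fun _ => s) hs continuous_id
    (continuousOn_reverse hh) fun _ => hs'
  have C1 : ∀ (x : E) (t : ℝ), ‖x‖ = 1 → 0 ≤ t → t ≤ 1 → C ((1 + t) • x) = h (x, 1 - t) :=
    fun x t hx h0 h1 => collar_smul (q := fun z => h (z.1, 1 - z.2)) hs' hx h0 h1
  have C2 : ∀ x, ‖x‖ = 1 → C ((2 : ℝ) • x) = f (y x) := fun x hx => by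
    rw [← h0 x hx, ← one_add_one_eq_two, C1 x 1 hx zero_le_one le_rfl, sub_self]
  obtain ⟨g, hg, hgy, G, hG, G0, G1, GS⟩ := hL y _ hy (show Continuous fun x => C ((2 : ℝ) • x)
    by fun_prop) C2
  -- `ρ` reparametrizes the cylinder over the ball on which `G` lives. The bottom is sent onto the
  -- bottom and the side, matching the collar of `y` added to `g`. The top goes to the inner half of
  -- the top, where `G` shows `s`, and the side to the outer annulus of the top, where `G` shows
  -- `h`.
  let ρ : E × ℝ → E × ℝ := fun z =>
    (((1 - z.2) * (max ‖z.1‖ (1 / 2))⁻¹ + z.2 / 2) • z.1,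
      max 0 (min 1 (2 * ‖z.1‖ - 1 + 2 * z.2)))
  have hinv : Continuous fun z : E × ℝ => (max ‖z.1‖ (1 / 2))⁻¹ :=
    Continuous.inv₀ (by fun_prop) fun x => by positivity
  have hρ : Continuous ρ := by fun_prop
  have hhy : ContinuousOn (fun z : E × ℝ => y z.1)
      {z | ‖z.1‖ = 1 ∧ z.2 ∈ Set.Icc (0 : ℝ) 1} :=
    hy.comp continuousOn_fst fun z hz => hz.1
  have cg : ∀ (x : E) (t : ℝ), ‖x‖ = 1 → 0 ≤ t → t ≤ 1 →
      collar g (fun z : E × ℝ => y z.1) ((1 + t : ℝ) • x) = y x :=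
    fun x t hx h0 h1 => collar_smul (q := fun z : E × ℝ => y z.1) hgy hx h0 h1
  refine ⟨fun x => collar g (fun z => y z.1) ((2 : ℝ) • x), fun z => G (ρ z),
    continuous_collar (A := fun _ => g) (by fun_prop) (by fun_prop) hhy fun _ => hgy,
    by fun_prop, fun x hx => ?_, fun x hx => ?_, fun x hx => ?_, fun x t hx ht0 ht1 => ?_⟩
  · dsimp only
    rw [← one_add_one_eq_two, cg x 1 hx zero_le_one le_rfl]
  · dsimp only
    rcases le_total ‖x‖ (1 / 2) with hx' | hx'
    · have hn : ‖(2 : ℝ) • x‖ ≤ 1 := by rw [norm_two_smul]; linarith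
      rw [collar_of_le _ _ hn]
      have : ρ (x, 0) = ((2 : ℝ) • x, 0) := by
        simp only [ρ, max_eq_right hx']
        refine Prod.ext ?_ ?_
        · norm_num
        · dsimp
          rw [max_eq_left]
          exact (min_le_right _ _).trans (by linarith)
      rw [this]
      exact G0 _ hn
    · obtain ⟨p, hp, hxp⟩ := exists_eq_smul (by norm_num) hx'
      have e1 : (2 : ℝ) • x = (1 + (2 * ‖x‖ - 1)) • p := by
        conv_lhs => rw [hxp, smul_smul]
        ring_nf
      rw [e1, cg p _ hp (by linarith) (by linarith)]
      have : ρ (x, 0) = (p, 2 * ‖x‖ - 1) := by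
        have h0 : ‖x‖ ≠ 0 := by positivity
        simp only [ρ, max_eq_left hx']
        refine Prod.ext ?_ ?_
        · dsimp
          conv_lhs => rw [hxp, smul_smul, ← hxp]
          rw [zero_div, add_zero, sub_zero, one_mul, inv_mul_cancel₀ h0, one_smul]
        · dsimp
          rw [mul_zero, add_zero, min_eq_right (by linarith), max_eq_right (by linarith)]
      rw [this, GS _ _ hp (by linarith) (by linarith), Function.comp_apply, hgy p hp]
  · have : ρ (x, 1) = ((1 / 2 : ℝ) • x, 1) := by
      have := norm_nonneg x
      refine Prod.ext ?_ ?_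
      · simp [ρ]
      · dsimp [ρ]
        rw [min_eq_left (by linarith), max_eq_right zero_le_one]
    have hn : ‖(1 / 2 : ℝ) • x‖ ≤ 1 := by
      rw [norm_smul, Real.norm_eq_abs]
      norm_num
      linarith
    simp only [this]
    rw [G1 _ hn]
    dsimp only
    rw [smul_smul]
    norm_num [C, collar_of_le _ _ hx]
  · have : ρ (x, t) = ((1 - t / 2) • x, 1) := by
      refine Prod.ext ?_ ?_
      · simp only [ρ, hx]
        norm_num
        congr 1
        ring
      · dsimp [ρ]
        rw [min_eq_left (by rw [hx]; linarith), max_eq_right zero_le_one]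
    have hn : ‖(1 - t / 2) • x‖ ≤ 1 := by
      rw [norm_smul, Real.norm_eq_abs, abs_of_nonneg (by linarith), hx]
      linarith
    simp only [this]
    rw [G1 _ hn]
    dsimp only
    rw [smul_smul]
    have e : 2 * (1 - t / 2) = 1 + (1 - t) := by ring
    rw [e, C1 _ _ hx (by linarith) (by linarith)]
    simp

end Balls

/-! ### Weak homotopy equivalences lift on balls -/

section Cubes

open unitInterval

variable {W : Type*} [TopologicalSpace W] {n : ℕ}

/-- The map from `ℝⁿ` to the unit cube that identifies the unit ball of the sup norm with it. -/
noncomputable def toCube (x : Fin n → ℝ) : Fin n → I :=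
  fun i => Set.projIcc 0 1 zero_le_one ((x i + 1) / 2)

/-- The identification of the unit cube with the unit ball of the sup norm. -/
noncomputable def ofCube (t : Fin n → I) : Fin n → ℝ := fun i => 2 * (t i : ℝ) - 1

@[fun_prop]
lemma continuous_toCube : Continuous (toCube (n := n)) :=
  continuous_pi fun i => continuous_projIcc.comp (by fun_prop)

@[fun_prop]
lemma continuous_ofCube : Continuous (ofCube (n := n)) := by
  unfold ofCube
  fun_prop

lemma ofCube_toCube {x : Fin n → ℝ} (hx : ‖x‖ ≤ 1) : ofCube (toCube x) = x := by
  funext i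
  have h := abs_le.1 ((norm_le_pi_norm x i).trans hx)
  have : (x i + 1) / 2 ∈ Set.Icc (0 : ℝ) 1 := ⟨by linarith, by linarith⟩
  simp only [ofCube, toCube, Set.projIcc_of_mem _ this]
  ring

lemma norm_ofCube_le (t : Fin n → I) : ‖ofCube t‖ ≤ 1 :=
  (pi_norm_le_iff_of_nonneg zero_le_one).2 fun i =>
    abs_le.2 ⟨by simp only [ofCube]; linarith [(t i).2.1], by simp only [ofCube]; linarith [(t i).2.2]⟩

lemma norm_ofCube_of_mem {t : Fin n → I} (ht : t ∈ Cube.boundary (Fin n)) : ‖ofCube t‖ = 1 := by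
  refine le_antisymm (norm_ofCube_le t) ?_
  obtain ⟨i, hi⟩ := ht
  have : ‖ofCube t i‖ = 1 := by
    rcases hi with hi | hi <;> norm_num [ofCube, hi]
  exact this.symm.trans_le (norm_le_pi_norm _ i)

lemma toCube_mem {x : Fin (n + 1) → ℝ} (hx : ‖x‖ = 1) : toCube x ∈ Cube.boundary (Fin (n + 1)) := by
  have : ∃ i, 1 ≤ |x i| := by
    by_contra! h
    exact ((pi_norm_lt_iff zero_lt_one).2 h).ne hx
  obtain ⟨i, hi⟩ := this
  refine ⟨i, ?_⟩
  rcases le_abs.1 hi with h | h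
  · right
    exact Set.projIcc_of_right_le _ (by linarith)
  · left
    exact Set.projIcc_of_le_left _ (by linarith)

lemma homotopic_iff_ballHomotopic {w : W} {p q : GenLoop (Fin (n + 1)) W w}
    {u v : (Fin (n + 1) → ℝ) → W} (hp : ∀ t, p t = u (ofCube t)) (hq : ∀ t, q t = v (ofCube t)) :
    GenLoop.Homotopic p q ↔ BallHomotopic u v := by
  constructor
  · rintro ⟨H⟩
    refine ⟨fun z => H (Set.projIcc 0 1 zero_le_one z.2, toCube z.1), ?_, fun x hx => ?_,
      fun x hx => ?_, fun x t hx h0 h1 => ?_⟩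
    · exact H.continuous.comp
        ((continuous_projIcc.comp continuous_snd).prodMk (by fun_prop))
    · dsimp only
      rw [Set.projIcc_left]
      refine (H.apply_zero _).trans ((hp _).trans ?_)
      rw [ofCube_toCube hx]
    · dsimp only
      rw [Set.projIcc_right]
      refine (H.apply_one _).trans ((hq _).trans ?_)
      rw [ofCube_toCube hx]
    · refine (H.eq_fst _ (toCube_mem hx)).trans ((hp _).trans ?_)
      rw [ofCube_toCube hx.le]
  · rintro ⟨G, hG, G0, G1, GS⟩
    exact ⟨{
      toFun := fun z => G (ofCube z.2, z.1)
      continuous_toFun := by fun_prop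
      map_zero_left := fun t => (G0 _ (norm_ofCube_le t)).trans (hp t).symm
      map_one_left := fun t => (G1 _ (norm_ofCube_le t)).trans (hq t).symm
      prop' := fun s t ht =>
        (GS _ _ (norm_ofCube_of_mem ht) s.2.1 s.2.2).trans (hp t).symm }⟩

/-- The generalized loop given by a map on the ball that is constant on the sphere. -/
noncomputable def genLoopOfBall {w : W} (g : (Fin n → ℝ) → W) (hg : Continuous g)
    (h : ∀ x, ‖x‖ = 1 → g x = w) : GenLoop (Fin n) W w :=
  ⟨⟨fun t => g (ofCube t), by fun_prop⟩, fun _ ht => h _ (norm_ofCube_of_mem ht)⟩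

variable {Y Z : Type u} [TopologicalSpace Y] [TopologicalSpace Z]

lemma IsWeakHomotopyEquiv.injBall_succ {f : C(Y, Z)} (hf : IsWeakHomotopyEquiv f) (n : ℕ) :
    InjBall f (Fin (n + 1) → ℝ) := by
  intro y₀ g hg hgS h
  refine (homotopic_iff_ballHomotopic (p := genLoopOfBall g hg hgS) (q := GenLoop.const)
    (fun _ => rfl) (fun _ => rfl)).1 (Quotient.exact ((hf.2 n y₀).1 ?_))
  exact Quotient.sound ((homotopic_iff_ballHomotopic (p := genLoopMap f (genLoopOfBall g hg hgS))
    (q := genLoopMap f GenLoop.const) (fun _ => rfl) (fun _ => rfl)).2 h)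

lemma IsWeakHomotopyEquiv.surjBall_succ {f : C(Y, Z)} (hf : IsWeakHomotopyEquiv f) (n : ℕ) :
    SurjBall f (Fin (n + 1) → ℝ) := by
  intro y₀ s hs hsS
  obtain ⟨p, hp⟩ := (hf.2 n y₀).2 (Quotient.mk _ (genLoopOfBall s hs hsS))
  induction p using Quotient.inductionOn with | _ p
  have h : GenLoop.Homotopic (genLoopMap f p) (genLoopOfBall s hs hsS) := Quotient.exact hp
  refine ⟨fun x => p (toCube x), p.1.continuous.comp (by fun_prop),
    fun x hx => p.2 _ (toCube_mem hx), (homotopic_iff_ballHomotopic (fun t => ?_)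
    fun t => rfl).1 h⟩
  have : toCube (ofCube t) = t := by
    funext i
    have e : (2 * (t i : ℝ) - 1 + 1) / 2 = t i := by ring
    simp only [toCube, ofCube, e, Set.projIcc_val]
  simp only [Function.comp_apply, this]
  rfl

lemma norm_fin_zero (x : Fin 0 → ℝ) : ‖x‖ = 0 := by
  rw [Subsingleton.elim x 0, norm_zero]

lemma ballHomotopic_of_joined {u v : (Fin 0 → ℝ) → W} (h : Joined (u 0) (v 0)) :
    BallHomotopic u v := by
  obtain ⟨γ⟩ := h
  refine ⟨fun z => γ.extend z.2, by fun_prop, fun x _ => ?_, fun x _ => ?_, fun x t hx => ?_⟩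
  · simp [Subsingleton.elim x 0]
  · simp [Subsingleton.elim x 0]
  · exact absurd hx (by rw [norm_fin_zero]; exact zero_ne_one)

/-- The ball of `ℝ⁰` is a point and its sphere is empty, so this is injectivity on path components.
-/
lemma IsWeakHomotopyEquiv.injBall_zero {f : C(Y, Z)} (hf : IsWeakHomotopyEquiv f) :
    InjBall f (Fin 0 → ℝ) := by
  rintro y₀ g hg - ⟨G, hG, G0, G1, -⟩
  refine ballHomotopic_of_joined (Quotient.exact (hf.1.1 (Quotient.sound ?_)))
  have h0 : ‖(0 : Fin 0 → ℝ)‖ ≤ 1 := (norm_fin_zero 0).trans_le zero_le_one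
  exact ⟨⟨⟨fun t => G (0, t), by fun_prop⟩, G0 0 h0, G1 0 h0⟩⟩

lemma IsWeakHomotopyEquiv.liftsBall_zero {f : C(Y, Z)} (hf : IsWeakHomotopyEquiv f) :
    LiftsBall f (Fin 0 → ℝ) := by
  intro y s _ _ _
  obtain ⟨p, hp⟩ := hf.1.2 (Quotient.mk _ (s 0))
  induction p using Quotient.inductionOn with | _ p
  refine ⟨fun _ => p, continuous_const, fun x hx => ?_, ballHomotopic_of_joined (Quotient.exact hp)⟩
  exact absurd hx (by rw [norm_fin_zero]; exact zero_ne_one)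

/-- Ball and sphere depend only on the norm, so linearity of `e` plays no role. This passes between
`ℝⁿ × ℝ` and `ℝⁿ⁺¹`, both with the sup norm. -/
lemma Liftable.of_homeomorph {E E' : Type*} [NormedAddCommGroup E] [NormedSpace ℝ E]
    [NormedAddCommGroup E'] [NormedSpace ℝ E'] (e : E ≃ₜ E') (he : ∀ x, ‖e x‖ = ‖x‖) {f : Y → Z}
    {y : E' → Y} {s : E' → Z} (h : Liftable f (y ∘ e) (s ∘ e)) : Liftable f y s := by
  have he' : ∀ x, ‖e.symm x‖ = ‖x‖ := fun x => by rw [← he, e.apply_symm_apply]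
  obtain ⟨g, hg, hgy, G, hG, G0, G1, GS⟩ := h
  refine ⟨fun x => g (e.symm x), by fun_prop, fun x hx => ?_, fun z => G (e.symm z.1, z.2),
    by fun_prop, fun x hx => ?_, fun x hx => ?_, fun x t hx h0 h1 => ?_⟩
  · simp [hgy (e.symm x) ((he' x).trans hx)]
  · exact G0 _ ((he' x).trans_le hx)
  · simp [G1 _ ((he' x).trans_le hx)]
  · exact GS _ _ ((he' x).trans hx) h0 h1

/-- `ℝⁿ × ℝ ≃ ℝⁿ⁺¹`. -/
def prodHomeomorphFinSucc (n : ℕ) : (Fin n → ℝ) × ℝ ≃ₜ (Fin (n + 1) → ℝ) where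
  toFun z := Fin.cons z.2 z.1
  invFun x := (Fin.tail x, x 0)
  left_inv z := by simp
  right_inv x := by simp
  continuous_toFun := by fun_prop
  continuous_invFun := by unfold Fin.tail; fun_prop

lemma norm_prodHomeomorphFinSucc (z : (Fin n → ℝ) × ℝ) : ‖prodHomeomorphFinSucc n z‖ = ‖z‖ := by
  change ‖(Fin.cons z.2 z.1 : Fin (n + 1) → ℝ)‖ = ‖z‖
  refine le_antisymm ((pi_norm_le_iff_of_nonneg (norm_nonneg _)).2
    (Fin.forall_fin_succ.2 ⟨norm_snd_le z, fun i => ?_⟩)) (norm_prod_le_iff.2 ⟨?_, ?_⟩)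
  · exact (norm_le_pi_norm z.1 i).trans (norm_fst_le z)
  · exact (pi_norm_le_iff_of_nonneg (norm_nonneg _)).2 fun i =>
      norm_le_pi_norm (Fin.cons z.2 z.1 : Fin (n + 1) → ℝ) i.succ
  · exact norm_le_pi_norm (Fin.cons z.2 z.1 : Fin (n + 1) → ℝ) 0

/-- Weak homotopy equivalences lift on balls up to homotopy. -/
lemma IsWeakHomotopyEquiv.liftsBall {f : C(Y, Z)} (hf : IsWeakHomotopyEquiv f) (n : ℕ) :
    LiftsBall f (Fin n → ℝ) := by
  cases n with
  | zero => exact hf.liftsBall_zero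
  | succ n =>
    -- Lifting on the ball of dimension `n + 1` combines injectivity in dimension `n`, where
    -- dimension zero means path components, with surjectivity in dimension `n + 1`.
    have hI : InjBall f (Fin n → ℝ) := by
      cases n with
      | zero => exact hf.injBall_zero
      | succ n => exact hf.injBall_succ n
    let e := prodHomeomorphFinSucc n
    have he : ∀ z, ‖e z‖ = ‖z‖ := norm_prodHomeomorphFinSucc
    have he' : ∀ x, ‖e.symm x‖ = ‖x‖ := fun x => by rw [← he, e.apply_symm_apply]
    have hS : SurjBall f ((Fin n → ℝ) × ℝ) := fun y₀ s hs hsS =>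
      Liftable.of_homeomorph e.symm he' (hf.surjBall_succ n y₀ (s ∘ e.symm) (by fun_prop)
        fun x hx => hsS _ ((he' x).trans hx))
    intro y s hy hs hys
    exact Liftable.of_homeomorph e he (liftsBall_prod f.continuous hI hS _ _
      (hy.comp e.continuous.continuousOn fun z hz => (he z).trans hz) (by fun_prop)
      fun z hz => hys _ ((he z).trans hz))

end Cubes

/-! ### Mapping path spaces -/

section MappingPath

open unitInterval

variable {Y Z : Type u} [TopologicalSpace Y] [TopologicalSpace Z]

/-- The mapping path space of `f`: points of `Y` with a path in `Z` that starts at the image. -/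
def MappingPath (f : C(Y, Z)) : Type u := {p : Y × C(I, Z) // p.2 0 = f p.1}

instance (f : C(Y, Z)) : TopologicalSpace (MappingPath f) := instTopologicalSpaceSubtype

namespace MappingPath

variable (f : C(Y, Z))

/-- The projection of the mapping path space to `Y`. -/
def source : C(MappingPath f, Y) := ⟨fun p => p.1.1, by
  exact continuous_fst.comp continuous_subtype_val⟩

/-- The fibration of the mapping path space over `Z`: the end point of the path. -/
def target : C(MappingPath f, Z) := ⟨fun p => p.1.2 1, by
  exact (continuous_eval_const (1 : I)).comp (continuous_snd.comp continuous_subtype_val)⟩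

/-- The inclusion of `Y` into the mapping path space by constant paths. -/
def const : C(Y, MappingPath f) := ⟨fun y => ⟨(y, ContinuousMap.const _ (f y)), rfl⟩, by
  refine Continuous.subtype_mk (continuous_id.prodMk ?_) _
  exact ContinuousMap.continuous_const'.comp f.continuous⟩

lemma target_comp_const : (target f).comp (const f) = f := rfl

lemma source_comp_const : (source f).comp (const f) = ContinuousMap.id Y := rfl

/-- The mapping path space deformation retracts to `Y`. -/
lemma const_comp_source_homotopic :
    ((const f).comp (source f)).Homotopic (ContinuousMap.id (MappingPath f)) := by
  -- At time `z.1` only the initial segment of that length of the path is kept, run at reduced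
  -- speed.
  refine ⟨⟨⟨fun z => ⟨(z.2.1.1, ⟨fun t => z.2.1.2 (z.1 * t), by fun_prop⟩), ?_⟩, ?_⟩, ?_, ?_⟩⟩
  · simpa using z.2.2
  · refine Continuous.subtype_mk (Continuous.prodMk ?_ ?_) _
    · exact continuous_fst.comp (continuous_subtype_val.comp continuous_snd)
    · refine ContinuousMap.continuous_of_continuous_uncurry _ ?_
      have h1 : Continuous fun q : (I × MappingPath f) × I => q.1.2.1.2 :=
        continuous_snd.comp (continuous_subtype_val.comp (continuous_snd.comp continuous_fst))
      exact h1.eval (by fun_prop)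
  · intro p
    refine Subtype.ext (Prod.ext rfl (ContinuousMap.ext fun t => ?_))
    change p.1.2 (0 * t) = f p.1.1
    rw [zero_mul]
    exact p.2
  · intro p
    refine Subtype.ext (Prod.ext rfl (ContinuousMap.ext fun t => ?_))
    simp

variable {f}

/-- The fibration of the mapping path space lifts strictly on balls. -/
lemma exists_lift_ball {E : Type*} [NormedAddCommGroup E] [NormedSpace ℝ E]
    (hL : LiftsBall f E) {a : E → MappingPath f} {s : E → Z}
    (ha : ContinuousOn a {x | ‖x‖ = 1}) (hs : Continuous s)
    (h : ∀ x, ‖x‖ = 1 → target f (a x) = s x) :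
    ∃ g : E → MappingPath f, Continuous g ∧ (∀ x, ‖x‖ = 1 → g x = a x) ∧
      ∀ x, ‖x‖ ≤ 1 → target f (g x) = s x := by
  have h1 : ContinuousOn (fun z : E × ℝ => (a z.1).1.2)
      {z | ‖z.1‖ = 1 ∧ z.2 ∈ Set.Icc (0 : ℝ) 1} :=
    (continuous_snd.comp continuous_subtype_val).comp_continuousOn
      (ha.comp continuousOn_fst fun z hz => hz.1)
  have h2 : ContinuousOn (fun z : E × ℝ => (a z.1).1.2 (Set.projIcc 0 1 zero_le_one z.2))
      {z | ‖z.1‖ = 1 ∧ z.2 ∈ Set.Icc (0 : ℝ) 1} :=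
    h1.eval (continuous_projIcc.comp continuous_snd).continuousOn
  -- The points of `a` provide the boundary map to `Y` and their paths provide the homotopy along
  -- which the lifting problem commutes.
  obtain ⟨g, H, hg, hH, hga, H0, H1, HS⟩ := hL.exists_path_lift (y := fun x => (a x).1.1)
    ((source f).continuous.comp_continuousOn ha) hs h2
    (fun x _ => by simpa using (a x).2) (fun x hx => by simpa [target] using h x hx)
  -- The homotopy `H` becomes the path coordinate of the lift. Its start is known to be `f (g x)`
  -- only on the ball, so the retraction is needed to land in `MappingPath f` everywhere.
  refine ⟨fun x => ⟨(g (ballRetract x), ⟨fun t => H (ballRetract x, t), by fun_prop⟩),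
    H0 _ (norm_ballRetract_le x)⟩, ?_, fun x hx => ?_, fun x hx => ?_⟩
  · refine Continuous.subtype_mk (Continuous.prodMk (by fun_prop) ?_) _
    refine ContinuousMap.continuous_of_continuous_uncurry _ ?_
    exact hH.comp (by fun_prop)
  · refine Subtype.ext (Prod.ext ?_ (ContinuousMap.ext fun t => ?_))
    · simpa [ballRetract_of_le hx.le] using hga x hx
    · simpa [ballRetract_of_le hx.le] using HS x t hx t.2.1 t.2.2
  · simpa [ballRetract_of_le hx, target] using H1 x hx

end MappingPath

end MappingPath

/-! ### Lifting on simplices -/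

section Simplices

variable {n : ℕ}

/-- The projection of the standard simplex to `ℝⁿ`. -/
def cornerSimplex (n : ℕ) : Set (Fin n → ℝ) := {u | (∀ i, 0 ≤ u i) ∧ ∑ i, u i ≤ 1}

lemma isClosed_cornerSimplex : IsClosed (cornerSimplex n) := by
  refine IsClosed.inter (s₁ := {u : Fin n → ℝ | ∀ i, 0 ≤ u i})
    (s₂ := {u : Fin n → ℝ | ∑ i, u i ≤ 1}) ?_ (isClosed_le (by fun_prop) continuous_const)
  have : {u : Fin n → ℝ | ∀ i, 0 ≤ u i} = ⋂ i, {u | 0 ≤ u i} := by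
    ext; simp
  rw [this]
  exact isClosed_iInter fun i => isClosed_le continuous_const (by fun_prop)

lemma convex_cornerSimplex : Convex ℝ (cornerSimplex n) := by
  rintro x ⟨hx, hx'⟩ y ⟨hy, hy'⟩ a b ha hb hab
  refine ⟨fun i => ?_, ?_⟩
  · have := mul_nonneg ha (hx i)
    have := mul_nonneg hb (hy i)
    simp only [Pi.add_apply, Pi.smul_apply, smul_eq_mul]
    linarith
  · simp only [Pi.add_apply, Pi.smul_apply, smul_eq_mul, Finset.sum_add_distrib,
      ← Finset.mul_sum]
    nlinarith

lemma isBounded_cornerSimplex : Bornology.IsBounded (cornerSimplex n) := by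
  refine Metric.isBounded_closedBall.subset (t := Metric.closedBall 0 1) fun u hu => ?_
  rw [mem_closedBall_zero_iff, pi_norm_le_iff_of_nonneg zero_le_one]
  intro i
  rw [Real.norm_eq_abs, abs_of_nonneg (hu.1 i)]
  exact (Finset.single_le_sum (fun j _ => hu.1 j) (Finset.mem_univ i)).trans hu.2

lemma mem_interior_cornerSimplex {u : Fin n → ℝ} :
    u ∈ interior (cornerSimplex n) ↔ (∀ i, 0 < u i) ∧ ∑ i, u i < 1 := by
  constructor
  · intro h
    -- An interior point may be moved slightly in both directions along any line. A negative
    -- multiple of a basis vector forces positive coordinates, and a positive multiple of `u` itself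
    -- forces the sum below one.
    have key : ∀ v : Fin n → ℝ, ∀ᶠ t in nhds (0 : ℝ), u + t • v ∈ cornerSimplex n := by
      intro v
      have hc : ContinuousAt (fun t : ℝ => u + t • v) 0 := by fun_prop
      exact hc (by simpa using mem_interior_iff_mem_nhds.1 h)
    refine ⟨fun i => ?_, ?_⟩
    · obtain ⟨ε, hε, h'⟩ := Metric.eventually_nhds_iff.1 (key (Pi.single i 1))
      have := (h' (y := -(ε / 2)) (by
        rw [dist_zero_right, Real.norm_eq_abs, abs_neg, abs_of_pos (by linarith)]
        linarith)).1 i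
      simp at this
      linarith
    · obtain ⟨ε, hε, h'⟩ := Metric.eventually_nhds_iff.1 (key u)
      have := (h' (y := ε / 2) (by
        rw [dist_zero_right, Real.norm_eq_abs, abs_of_pos (by linarith)]
        linarith)).2
      simp only [Pi.add_apply, Pi.smul_apply, smul_eq_mul, Finset.sum_add_distrib,
        ← Finset.mul_sum] at this
      nlinarith
  · intro h
    have ho : IsOpen {u : Fin n → ℝ | (∀ i, 0 < u i) ∧ ∑ i, u i < 1} := by
      refine IsOpen.inter (s := {u : Fin n → ℝ | ∀ i, 0 < u i})
        (t := {u : Fin n → ℝ | ∑ i, u i < 1}) ?_ (isOpen_lt (by fun_prop) continuous_const)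
      have : {u : Fin n → ℝ | ∀ i, 0 < u i} = ⋂ i, {u | 0 < u i} := by
        ext; simp
      rw [this]
      exact isOpen_iInter_of_finite fun i => isOpen_lt continuous_const (by fun_prop)
    have hsub : {u : Fin n → ℝ | (∀ i, 0 < u i) ∧ ∑ i, u i < 1} ⊆ cornerSimplex n :=
      fun v hv => ⟨fun i => (hv.1 i).le, hv.2.le⟩
    exact interior_maximal hsub ho h

/-- The point of the standard simplex with given coordinates but the first. -/
def simplexOfCorner (u : cornerSimplex n) : stdSimplex ℝ (Fin (n + 1)) :=
  ⟨Fin.cons (1 - ∑ i, u.1 i) u.1, by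
    refine Fin.forall_fin_succ.2 ⟨?_, fun i => ?_⟩
    · simpa using u.2.2
    · simpa using u.2.1 i, by simp [Fin.sum_univ_succ]⟩

lemma sum_tail (x : stdSimplex ℝ (Fin (n + 1))) : ∑ i : Fin n, x.1 i.succ = 1 - x.1 0 := by
  have := x.2.2
  rw [Fin.sum_univ_succ] at this
  linarith

/-- The standard simplex as a retract of `ℝⁿ`, with its boundary in the unit sphere. -/
lemma exists_simplex_chart (n : ℕ) :
    ∃ (φ : stdSimplex ℝ (Fin (n + 1)) → (Fin n → ℝ)) (ψ : (Fin n → ℝ) → stdSimplex ℝ (Fin (n + 1))),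
      Continuous φ ∧ Continuous ψ ∧ (∀ x, ψ (φ x) = x) ∧ (∀ x, ‖φ x‖ ≤ 1) ∧
      (∀ x, (∃ i, x i = 0) → ‖φ x‖ = 1) ∧ ∀ z, ‖z‖ = 1 → ∃ i, ψ z i = 0 := by
  have hne : (interior (cornerSimplex n)).Nonempty := by
    refine ⟨fun _ => ((n : ℝ) + 1)⁻¹, mem_interior_cornerSimplex.2 ⟨fun i => by positivity, ?_⟩⟩
    simp only [Finset.sum_const, Finset.card_univ, Fintype.card_fin, nsmul_eq_mul]
    rw [mul_inv_lt_iff₀ (by positivity)]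
    linarith
  -- A bounded convex set with nonempty interior is carried to the unit ball by a homeomorphism of
  -- the whole space that matches frontier and sphere. The interior point used is the barycentre.
  obtain ⟨e, -, h1, h2⟩ := exists_homeomorph_image_interior_closure_frontier_eq_unitBall
    (convex_cornerSimplex (n := n)) hne isBounded_cornerSimplex
  rw [isClosed_cornerSimplex.closure_eq] at h1
  have hmem : ∀ z : Fin n → ℝ, ‖z‖ ≤ 1 → e.symm z ∈ cornerSimplex n := by
    intro z hz
    have : z ∈ e '' cornerSimplex n := h1 ▸ mem_closedBall_zero_iff.2 hz
    obtain ⟨u, hu, rfl⟩ := this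
    simpa using hu
  have htail : ∀ x : stdSimplex ℝ (Fin (n + 1)), (fun i => x.1 i.succ) ∈ cornerSimplex n :=
    fun x => ⟨fun i => x.2.1 _, by rw [sum_tail]; linarith [x.2.1 0]⟩
  have hle : ∀ x : stdSimplex ℝ (Fin (n + 1)), ‖e fun i => x.1 i.succ‖ ≤ 1 := fun x =>
    mem_closedBall_zero_iff.1 (h1 ▸ Set.mem_image_of_mem e (htail x))
  refine ⟨fun x => e fun i => x.1 i.succ,
    fun z => simplexOfCorner ⟨e.symm (ballRetract z), hmem _ (norm_ballRetract_le z)⟩,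
    e.continuous.comp (continuous_pi fun i => (continuous_apply _).comp continuous_subtype_val),
    ?_, fun x => ?_, hle, fun x hx => ?_, fun z hz => ?_⟩
  · refine Continuous.subtype_mk ?_ _
    refine Continuous.finCons ?_ ?_ <;> fun_prop
  · refine Subtype.ext ?_
    simp only [simplexOfCorner, ballRetract_of_le (hle x), e.symm_apply_apply, sum_tail,
      sub_sub_cancel]
    exact Fin.cons_self_tail x.1
  · rw [← mem_sphere_zero_iff_norm, ← h2]
    refine Set.mem_image_of_mem e ⟨subset_closure (htail x), fun hint => ?_⟩
    rw [mem_interior_cornerSimplex, sum_tail] at hint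
    obtain ⟨i, hi⟩ := hx
    refine Fin.cases (fun hi => ?_) (fun i hi => ?_) i hi
    · have : x.1 0 = 0 := hi
      linarith [hint.2]
    · exact (hint.1 i).ne' hi
  · have hz' : z ∈ e '' frontier (cornerSimplex n) := h2 ▸ mem_sphere_zero_iff_norm.2 hz
    obtain ⟨u, hu, rfl⟩ := hz'
    rw [isClosed_cornerSimplex.frontier_eq] at hu
    by_contra! hne
    have hu' : ∀ h, simplexOfCorner ⟨e.symm (ballRetract (e u)), h⟩ =
        simplexOfCorner ⟨u, hu.1⟩ := fun h => by
      congr 2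
      rw [ballRetract_of_le hz.le, e.symm_apply_apply]
    simp only [hu'] at hne
    refine hu.2 (mem_interior_cornerSimplex.2 ⟨fun i => ?_, ?_⟩)
    · exact lt_of_le_of_ne (hu.1.1 i) (hne i.succ).symm
    · have : (1 - ∑ i, u i : ℝ) ≠ 0 := hne 0
      exact lt_of_le_of_ne hu.1.2 fun h => this (by rw [h, sub_self])

lemma map_succAbove_apply (i : Fin (n + 2)) (x : stdSimplex ℝ (Fin (n + 1))) (k : Fin (n + 1)) :
    stdSimplex.map i.succAbove x (i.succAbove k) = x k := by
  simp [FunOnFinite.linearMap_apply_apply, Finset.filter_eq']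

lemma map_succAbove_apply_self (i : Fin (n + 2)) (x : stdSimplex ℝ (Fin (n + 1))) :
    stdSimplex.map i.succAbove x i = 0 := by
  simp [FunOnFinite.linearMap_apply_apply, Fin.succAbove_ne]

lemma map_succAbove_injective (i : Fin (n + 2)) :
    Function.Injective (stdSimplex.map (S := ℝ) i.succAbove) := by
  intro x y h
  refine stdSimplex.ext (funext fun k => ?_)
  exact (map_succAbove_apply i x k).symm.trans (h ▸ map_succAbove_apply i y k)

lemma exists_map_succAbove {i : Fin (n + 2)} {x : stdSimplex ℝ (Fin (n + 2))} (hx : x i = 0) :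
    ∃ y, stdSimplex.map i.succAbove y = x := by
  refine ⟨⟨fun k => x (i.succAbove k), fun k => x.2.1 _, ?_⟩, ?_⟩
  · have := x.2.2
    rw [Fin.sum_univ_succAbove _ i] at this
    refine Eq.trans ?_ this
    have h0 : x.1 i = 0 := hx
    rw [h0, zero_add]
    rfl
  · refine stdSimplex.ext (funext fun k => ?_)
    rcases Fin.eq_self_or_eq_succAbove i k with rfl | ⟨j, rfl⟩
    · exact (map_succAbove_apply_self _ _).trans hx.symm
    · exact map_succAbove_apply _ _ _

/-- Compatible continuous maps on the faces of a simplex glue to a map on the boundary. -/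
lemma exists_glue_faces {W : Type*} [TopologicalSpace W]
    (a : Fin (n + 2) → C(stdSimplex ℝ (Fin (n + 1)), W))
    (ha : ∀ i j x y, stdSimplex.map i.succAbove x = stdSimplex.map j.succAbove y →
      a i x = a j y) :
    ∃ A : stdSimplex ℝ (Fin (n + 2)) → W, ContinuousOn A {x | ∃ i, x i = 0} ∧
      ∀ i x, A (stdSimplex.map i.succAbove x) = a i x := by
  classical
  -- Off the boundary the value is arbitrary; continuity is claimed on the boundary only.
  let A : stdSimplex ℝ (Fin (n + 2)) → W := fun x =>
    if h : ∃ (i : Fin (n + 2)) (y : _), stdSimplex.map i.succAbove y = x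
      then a h.choose h.choose_spec.choose else a 0 (stdSimplex.vertex 0)
  have hA : ∀ i x, A (stdSimplex.map i.succAbove x) = a i x := by
    intro i x
    have h : ∃ (j : Fin (n + 2)) (y : _), stdSimplex.map j.succAbove y =
      stdSimplex.map (S := ℝ) i.succAbove x := ⟨i, x, rfl⟩
    simp only [A, dif_pos h]
    exact ha _ _ _ _ h.choose_spec.choose_spec
  refine ⟨A, continuousOn_iff_isClosed.2 fun t ht => ?_, hA⟩
  -- The boundary is a finite union of compact faces, so the preimage of a closed set is a finite
  -- union of compact images.
  refine ⟨⋃ i : Fin (n + 2), stdSimplex.map i.succAbove '' (a i ⁻¹' t),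
    isClosed_iUnion_of_finite fun i => ?_, ?_⟩
  · exact ((ht.preimage (a i).continuous).isCompact.image
      (stdSimplex.continuous_map _)).isClosed
  · ext x
    simp only [Set.mem_inter_iff, Set.mem_preimage, Set.mem_ofPred_eq, Set.mem_iUnion,
      Set.mem_image]
    refine and_congr_left fun ⟨i, hi⟩ => ⟨fun hx => ?_, ?_⟩
    · obtain ⟨y, rfl⟩ := exists_map_succAbove hi
      exact ⟨i, y, by rwa [← hA], rfl⟩
    · rintro ⟨i, y, hy, rfl⟩
      rwa [hA]

/-- The simplex chart transports the problem to the ball: `ψ` takes the sphere into the boundary,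
and `φ` takes the boundary into the sphere and is undone by `ψ`. -/
lemma MappingPath.exists_lift_simplex {Y Z : Type u} [TopologicalSpace Y] [TopologicalSpace Z]
    {f : C(Y, Z)} (hL : LiftsBall f (Fin n → ℝ)) {a : stdSimplex ℝ (Fin (n + 1)) → MappingPath f}
    {s : stdSimplex ℝ (Fin (n + 1)) → Z} (ha : ContinuousOn a {x | ∃ i, x i = 0})
    (hs : Continuous s) (h : ∀ x, (∃ i, x i = 0) → target f (a x) = s x) :
    ∃ g : C(stdSimplex ℝ (Fin (n + 1)), MappingPath f), (∀ x, (∃ i, x i = 0) → g x = a x) ∧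
      ∀ x, target f (g x) = s x := by
  obtain ⟨φ, ψ, hφ, hψ, hψφ, hφ1, hφS, hψS⟩ := exists_simplex_chart n
  obtain ⟨g, hg, hga, hgs⟩ := exists_lift_ball hL (a := a ∘ ψ) (s := s ∘ ψ)
    (ha.comp hψ.continuousOn fun z hz => hψS z hz) (hs.comp hψ) fun z hz => h _ (hψS z hz)
  refine ⟨⟨fun x => g (φ x), hg.comp hφ⟩, fun x hx => ?_, fun x => ?_⟩
  · exact (hga _ (hφS x hx)).trans (congrArg a (hψφ x))
  · exact (hgs _ (hφ1 x)).trans (congrArg s (hψφ x))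

end Simplices

/-! ### The end point map is a trivial fibration on singular simplicial sets -/

section TrivialFibration

open Simplicial

variable {n : ℕ}

/-- Maps from a standard simplex to a singular simplicial set are continuous maps. -/
noncomputable def simplexMapEquiv {P : TopCat.{u}} :
    (Δ[n] ⟶ TopCat.toSSet.obj P) ≃ C(stdSimplex ℝ (Fin (n + 1)), P) :=
  SSet.yonedaEquiv.trans (TopCat.toSSetObjEquiv P (Opposite.op ⦋n⦌))

lemma simplexMapEquiv_δ {P : TopCat.{u}} (a : Δ[n + 1] ⟶ TopCat.toSSet.obj P) (i : Fin (n + 2))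
    (x : stdSimplex ℝ (Fin (n + 1))) :
    simplexMapEquiv (SSet.stdSimplex.δ i ≫ a) x = simplexMapEquiv a (stdSimplex.map i.succAbove x) := by
  dsimp only [simplexMapEquiv, Equiv.trans_apply]
  rw [SSet.stdSimplex.yonedaEquiv_δ_comp]
  exact TopCat.toSSetObjEquiv_δ_apply _ _ _

lemma simplexMapEquiv_map {P Q : TopCat.{u}} (a : Δ[n] ⟶ TopCat.toSSet.obj P) (p : P ⟶ Q)
    (x : stdSimplex ℝ (Fin (n + 1))) :
    simplexMapEquiv (a ≫ TopCat.toSSet.map p) x = p (simplexMapEquiv a x) := by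
  dsimp only [simplexMapEquiv, Equiv.trans_apply]
  rw [SSet.yonedaEquiv_comp]
  rfl

/-- The continuous maps on the faces given by a map from the boundary of a simplex. -/
noncomputable def boundaryFace {P : TopCat.{u}} (a : (∂Δ[n + 1] : SSet.{u}) ⟶ TopCat.toSSet.obj P)
    (i : Fin (n + 2)) : C(stdSimplex ℝ (Fin (n + 1)), P) :=
  simplexMapEquiv (SSet.boundary.ι i ≫ a)

lemma boundary_δ_comp_ι {i j : Fin (n + 2)} (h : i ≤ j) :
    SSet.stdSimplex.δ j ≫ SSet.boundary.ι.{u} i.castSucc =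
      SSet.stdSimplex.δ i ≫ SSet.boundary.ι.{u} j.succ := by
  rw [← cancel_mono (SSet.Subcomplex.ι _)]
  simp only [Category.assoc, SSet.boundary.ι_ι]
  exact (SSet.stdSimplex.δ_comp_δ h).symm

lemma boundaryFace_map_of_le {P : TopCat.{u}} (a : (∂Δ[n + 2] : SSet.{u}) ⟶ TopCat.toSSet.obj P)
    {i j : Fin (n + 2)} (h : i ≤ j) (x : stdSimplex ℝ (Fin (n + 1))) :
    boundaryFace a i.castSucc (stdSimplex.map j.succAbove x) =
      boundaryFace a j.succ (stdSimplex.map i.succAbove x) := by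
  simp only [boundaryFace, ← simplexMapEquiv_δ, ← Category.assoc, boundary_δ_comp_ι h]

lemma map_succAbove_map {i j : Fin (n + 2)} (h : i ≤ j) (x : stdSimplex ℝ (Fin (n + 1))) :
    stdSimplex.map j.succ.succAbove (stdSimplex.map i.succAbove x) =
      stdSimplex.map i.castSucc.succAbove (stdSimplex.map j.succAbove x) := by
  rw [stdSimplex.map_comp_apply, stdSimplex.map_comp_apply]
  congr 1
  funext k
  exact congrArg (fun φ => φ.toOrderHom k) (SimplexCategory.δ_comp_δ h)

/-- Faces `i < j` meet in a face of codimension two, whose two parametrizations are related by the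
simplicial identity, and there the boundary map has a single value. For an interval the two faces
are distinct vertices and do not meet. -/
lemma boundaryFace_compatible_of_lt {P : TopCat.{u}}
    (a : (∂Δ[n + 1] : SSet.{u}) ⟶ TopCat.toSSet.obj P)
    {i j : Fin (n + 2)} (hij : i < j) (x y : stdSimplex ℝ (Fin (n + 1)))
    (h : stdSimplex.map i.succAbove x = stdSimplex.map j.succAbove y) :
    boundaryFace a i x = boundaryFace a j y := by
  have hx : stdSimplex.map i.succAbove x j = 0 := by rw [h, map_succAbove_apply_self]
  cases n with
  | zero =>
    exfalso
    have hs := (stdSimplex.map (S := ℝ) i.succAbove x).2.2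
    have hi : (stdSimplex.map (S := ℝ) i.succAbove x) i = 0 := map_succAbove_apply_self i x
    obtain ⟨rfl, rfl⟩ : i = 0 ∧ j = 1 := by
      revert hij
      clear hs hi hx h
      revert i j
      decide
    rw [Fin.sum_univ_two] at hs
    have := congrArg₂ (· + ·) hi hx
    exact one_ne_zero (hs.symm.trans (this.trans (add_zero 0)))
  | succ n =>
    obtain ⟨i, rfl⟩ : ∃ i' : Fin (n + 2), i = i'.castSucc := ⟨i.castPred (by
      rintro rfl
      exact absurd (Fin.le_last j) (not_le.2 hij)), by simp⟩
    obtain ⟨j, rfl⟩ : ∃ j' : Fin (n + 2), j = j'.succ := ⟨j.pred (by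
      rintro rfl
      exact absurd (Fin.zero_le i.castSucc) (not_le.2 hij)), by simp⟩
    have hij' : i ≤ j := Fin.castSucc_lt_succ_iff.1 hij
    have hj : i.castSucc.succAbove j = j.succ := Fin.succAbove_of_lt_succ _ _ hij
    rw [← hj, map_succAbove_apply] at hx
    obtain ⟨w, rfl⟩ := exists_map_succAbove hx
    obtain rfl : stdSimplex.map i.succAbove w = y := by
      refine map_succAbove_injective j.succ ?_
      rw [← h, map_succAbove_map hij']
    exact boundaryFace_map_of_le a hij' w

lemma boundaryFace_compatible {P : TopCat.{u}} (a : (∂Δ[n + 1] : SSet.{u}) ⟶ TopCat.toSSet.obj P)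
    (i j : Fin (n + 2)) (x y : stdSimplex ℝ (Fin (n + 1)))
    (h : stdSimplex.map i.succAbove x = stdSimplex.map j.succAbove y) :
    boundaryFace a i x = boundaryFace a j y := by
  rcases lt_trichotomy i j with hij | rfl | hij
  · exact boundaryFace_compatible_of_lt a hij x y h
  · rw [map_succAbove_injective i h]
  · exact (boundaryFace_compatible_of_lt a hij y x h.symm).symm

variable {Y Z : Type u} [TopologicalSpace Y] [TopologicalSpace Z]

/-- The fibration of the mapping path space of a weak homotopy equivalence is a trivial fibration
on singular simplicial sets. -/
lemma IsWeakHomotopyEquiv.rlp_target {f : C(Y, Z)} (hf : IsWeakHomotopyEquiv f) :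
    SSet.modelCategoryQuillen.I.rlp
      (TopCat.toSSet.map (TopCat.ofHom (MappingPath.target f))) := by
  rintro _ _ _ ⟨n⟩
  refine ⟨fun {a b} sq => ?_⟩
  let s : C(stdSimplex ℝ (Fin (n + 1)), Z) := simplexMapEquiv b
  suffices h : ∃ g : C(stdSimplex ℝ (Fin (n + 1)), MappingPath f),
      ∂Δ[n].ι ≫ simplexMapEquiv.symm g = a ∧ ∀ x, MappingPath.target f (g x) = s x by
    obtain ⟨g, hg, hgs⟩ := h
    refine ⟨⟨simplexMapEquiv.symm g, hg, simplexMapEquiv.injective ?_⟩⟩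
    ext x
    rw [simplexMapEquiv_map, Equiv.apply_symm_apply]
    exact hgs x
  cases n with
  | zero =>
    have hne : ∀ x : stdSimplex ℝ (Fin 1), ¬ ∃ i, x i = 0 := by
      rintro x ⟨i, hi⟩
      have := x.2.2
      rw [Fin.sum_univ_one] at this
      obtain rfl := Subsingleton.elim i 0
      exact one_ne_zero (this.symm.trans hi)
    -- The boundary of a point is empty, so the prescribed boundary map is irrelevant, but some
    -- value in the mapping path space is needed. Surjectivity on path components supplies a point
    -- of `Y`.
    obtain ⟨p, -⟩ := hf.1.2 (Quotient.mk _ (s (stdSimplex.vertex 0)))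
    induction p using Quotient.inductionOn with | _ p
    obtain ⟨g, -, hg⟩ := MappingPath.exists_lift_simplex (hf.liftsBall 0)
      (a := fun _ => MappingPath.const f p) continuousOn_const s.continuous
      fun x hx => absurd hx (hne x)
    exact ⟨g, SSet.boundary.hom_ext₀, hg⟩
  | succ n =>
    obtain ⟨A, hA, hAa⟩ := exists_glue_faces (boundaryFace (P := TopCat.of (MappingPath f)) a)
      (boundaryFace_compatible a)
    obtain ⟨g, hga, hgs⟩ := MappingPath.exists_lift_simplex (hf.liftsBall (n + 1)) hA s.continuous
      fun x ⟨i, hi⟩ => by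
        obtain ⟨y, rfl⟩ := exists_map_succAbove hi
        rw [hAa]
        have h1 := simplexMapEquiv_map (SSet.boundary.ι i ≫ a)
          (TopCat.ofHom (MappingPath.target f)) y
        rw [Category.assoc, sq.w, SSet.boundary.ι_ι_assoc, simplexMapEquiv_δ] at h1
        exact h1.symm
    refine ⟨g, SSet.boundary.hom_ext fun i => simplexMapEquiv.injective ?_, hgs⟩
    ext x
    rw [SSet.boundary.ι_ι_assoc, simplexMapEquiv_δ, Equiv.apply_symm_apply,
      hga _ ⟨i, map_succAbove_apply_self i x⟩, hAa]
    rfl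

end TrivialFibration

/-! ### Simplicial homotopies and the cohomology of cochains -/

section CochainHomotopy

open Simplicial AlgebraicTopology

variable (K : Type v) [Field K] {S T : SSet.{u}}

/-- The simplicial free abelian group on a simplicial set. -/
noncomputable abbrev freeSimplicial (S : SSet.{u}) : SimplicialObject AddCommGrpCat.{u} :=
  ((SimplicialObject.whiskering _ _).obj AddCommGrpCat.free).obj S

/-- Evaluation of a function on simplices on chains. -/
noncomputable def evalChain {m : ℕ} (φ : S _⦋m⦌ → K) :
    ((alternatingFaceMapComplex AddCommGrpCat).obj (freeSimplicial S)).X m →+ K :=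
  FreeAbelianGroup.lift φ

/-- A simplex as a chain. -/
noncomputable def simplexChain {m : ℕ} (σ : S _⦋m⦌) :
    ((alternatingFaceMapComplex AddCommGrpCat).obj (freeSimplicial S)).X m :=
  FreeAbelianGroup.of σ

@[simp] lemma evalChain_simplexChain {m : ℕ} (φ : S _⦋m⦌ → K) (σ : S _⦋m⦌) :
    evalChain K φ (simplexChain σ) = φ σ := FreeAbelianGroup.lift_apply_of _ _

lemma simplexChain_map (f : S ⟶ T) {m : ℕ} (σ : S _⦋m⦌) :
    ((alternatingFaceMapComplex AddCommGrpCat).map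
      (((SimplicialObject.whiskering _ _).obj AddCommGrpCat.free).map f)).f m (simplexChain σ) =
    simplexChain (f.app _ σ) := FreeAbelianGroup.map_of_apply _ 

/-- Evaluation of morphisms of abelian groups at an element. -/
def evalHom {P Q : AddCommGrpCat.{u}} (x : P) : (P ⟶ Q) →+ Q :=
  AddMonoidHom.mk' (fun f => f x) fun _ _ => rfl

lemma simplexChain_δ {m : ℕ} (t : Fin (m + 2)) (σ : S _⦋m + 1⦌) :
    (freeSimplicial S).δ t (simplexChain σ) = simplexChain (S.δ t σ) :=
  FreeAbelianGroup.map_of_apply _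

lemma simplexChain_d {m : ℕ} (σ : S _⦋m + 1⦌) :
    ((alternatingFaceMapComplex AddCommGrpCat).obj (freeSimplicial S)).d (m + 1) m
      (simplexChain σ) = ∑ t : Fin (m + 2), (-1 : ℤ) ^ (t : ℕ) • simplexChain (S.δ t σ) := by
  rw [alternatingFaceMapComplex_obj_d]
  change evalHom (simplexChain σ) (∑ t : Fin (m + 2), _) = _
  rw [map_sum]
  refine Finset.sum_congr rfl fun t _ => ?_
  rw [map_zsmul]
  exact congrArg _ (simplexChain_δ t σ)

lemma chain_induction {m : ℕ}
    {a b : ((alternatingFaceMapComplex AddCommGrpCat).obj (freeSimplicial S)).X m →+ K}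
    (h : ∀ σ, a (simplexChain σ) = b (simplexChain σ)) : a = b :=
  FreeAbelianGroup.lift_ext a b h

/-- The coboundary is dual to the boundary of integral chains. This turns chain homotopies of free
abelian groups into statements about `K`-valued cochains, whatever the universe of `K`. -/
lemma evalChain_d {i j : ℤ} (h : i + 1 = j) (φ : Cochain K S i) (m : ℕ) (hm : (m : ℤ) = i)
    (hm' : ((m + 1 : ℕ) : ℤ) = j)
    (x : ((alternatingFaceMapComplex AddCommGrpCat).obj (freeSimplicial S)).X (m + 1)) :
    evalChain K (φ ⟨m, hm⟩)
      (((alternatingFaceMapComplex AddCommGrpCat).obj (freeSimplicial S)).d (m + 1) m x) =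
    evalChain K (Cochain.d K h φ ⟨m + 1, hm'⟩) x := by
  suffices (evalChain K (φ ⟨m, hm⟩)).comp
      (((alternatingFaceMapComplex AddCommGrpCat).obj (freeSimplicial S)).d (m + 1) m).hom =
      evalChain K (Cochain.d K h φ ⟨m + 1, hm'⟩) from DFunLike.congr_fun this x
  refine chain_induction K fun σ => ?_
  rw [evalChain_simplexChain, Cochain.d_succ]
  refine (congrArg (evalChain K (φ ⟨m, hm⟩)) (simplexChain_d σ)).trans ?_
  rw [map_sum]
  refine Finset.sum_congr rfl fun t _ => ?_
  rw [map_zsmul, evalChain_simplexChain, zsmul_eq_mul]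
  push_cast
  rfl

/-- Simplicially homotopic maps induce the same map on the cohomology of cochains. -/
lemma exists_d_eq_sub_of_homotopy {f g : S ⟶ T} (H : SimplicialObject.Homotopy f g)
    {k i j : ℤ} (hk : k + 1 = i) (hj : i + 1 = j) (φ : Cochain K T i)
    (hφ : Cochain.d K hj φ = 0) :
    ∃ ψ : Cochain K S k, Cochain.d K hk ψ = Cochain.map K f i φ - Cochain.map K g i φ := by
  let c := (H.whiskerRight AddCommGrpCat.free).toChainHomotopy
  -- The cochain `ψ` is `φ` evaluated on the chain homotopy `c`.
  refine ⟨fun m σ => evalChain K (φ ⟨m.1 + 1, by have := m.2; omega⟩)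
    (c.hom m.1 (m.1 + 1) (simplexChain σ)), ?_⟩
  funext ⟨m, hm⟩ σ
  let E : (((alternatingFaceMapComplex AddCommGrpCat).obj (freeSimplicial S)).X m ⟶
      ((alternatingFaceMapComplex AddCommGrpCat).obj (freeSimplicial T)).X m) →+ K :=
    (evalChain K (φ ⟨m, hm⟩)).comp (evalHom (simplexChain σ))
  have hE : ∀ (f : S ⟶ T), E (((alternatingFaceMapComplex AddCommGrpCat).map
      (((SimplicialObject.whiskering _ _).obj AddCommGrpCat.free).map f)).f m) =
      φ ⟨m, hm⟩ (f.app _ σ) := fun f =>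
    (congrArg (evalChain K (φ ⟨m, hm⟩)) (simplexChain_map f σ)).trans
      (evalChain_simplexChain K _ _)
  have key := congrArg E (c.comm m)
  rw [map_add, map_add, hE, hE, prevD_eq (j' := m + 1) (w := by simp)] at key
  -- The term in which the boundary is applied after `c` vanishes because `φ` is a cocycle; the
  -- other term is the coboundary of `ψ`.
  have hd : E (c.hom m (m + 1) ≫
      ((alternatingFaceMapComplex AddCommGrpCat).obj (freeSimplicial T)).d (m + 1) m) = 0 := by
    refine (evalChain_d K hj φ m hm (by omega) _).trans ?_
    rw [hφ]
    exact DFunLike.congr_fun (chain_induction K (a := evalChain K 0) (b := 0) fun σ => by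
      rw [evalChain_simplexChain]; rfl) _
  rw [hd, add_zero] at key
  change _ = φ ⟨m, hm⟩ (f.app _ σ) - φ ⟨m, hm⟩ (g.app _ σ)
  rw [key, add_sub_cancel_right]
  -- In degree zero no chains lie below, and the coboundary into degree zero is zero by definition.
  cases m with
  | zero =>
    rw [dNext_eq_zero _ _ (by simp), map_zero]
    rfl
  | succ m =>
    rw [dNext_eq (i' := m) (w := by simp)]
    let c' := (evalChain K (φ ⟨m + 1, hm⟩)).comp (c.hom m (m + 1)).hom
    refine Eq.trans ?_ (congrArg c' (simplexChain_d σ)).symm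
    rw [map_sum, Cochain.d_succ]
    refine Finset.sum_congr rfl fun t _ => ?_
    rw [map_zsmul, zsmul_eq_mul]
    push_cast
    rfl

end CochainHomotopy

/-! ### Trivial fibrations are simplicial homotopy equivalences -/

section Retraction

variable {S T : SSet.{u}}

open MonoidalCategory SSet Simplicial

lemma exists_homotopy_of_rlp (p : S ⟶ T) (hp : SSet.modelCategoryQuillen.I.rlp p) :
    ∃ s : T ⟶ S, s ≫ p = 𝟙 T ∧ Nonempty (SSet.Homotopy (𝟙 S) (p ≫ s)) := by
  -- Lifting against boundary inclusions is equivalent to lifting against all monomorphisms. The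
  -- inclusion of the empty simplicial set then yields a section.
  rw [← SSet.rlp_monomorphisms] at hp
  have h1 := hp (Limits.initial.to T) (inferInstanceAs (Mono _))
  have sq : CommSq (Limits.initial.to S) (Limits.initial.to T) p (𝟙 T) := ⟨Limits.initialIsInitial.hom_ext _ _⟩
  refine ⟨sq.lift, sq.fac_right, ?_⟩
  -- The two ends of the cylinder. They are disjoint because their `Δ[1]` coordinates are the
  -- constants `0` and `1`, so `i` is a monomorphism.
  let i : FunctorToTypes.coprod S S ⟶ S ⊗ Δ[1] := FunctorToTypes.coprod.desc ι₀ ι₁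
  have hi : Mono i := by
    rw [NatTrans.mono_iff_mono_app]
    rintro ⟨⟨n⟩⟩
    rw [mono_iff_injective]
    rintro (x | x) (y | y) h
    · exact congrArg Sum.inl (congrArg Prod.fst h)
    · exact absurd (DFunLike.congr_fun (show ((ι₀.app _ x).2 : Δ[1] _⦋n⦌) = (ι₁.app _ y).2 from
        congrArg Prod.snd h) 0) zero_ne_one
    · exact absurd (DFunLike.congr_fun (show ((ι₁.app _ x).2 : Δ[1] _⦋n⦌) = (ι₀.app _ y).2 from
        congrArg Prod.snd h) 0) one_ne_zero
    · exact congrArg Sum.inr (congrArg Prod.fst h)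
  have h2 := hp i hi
  -- The bottom map forgets the cylinder coordinate, so the lift is a homotopy along the fibres of
  -- `p` from the identity to `p` followed by the section.
  have sq' : CommSq (FunctorToTypes.coprod.desc (𝟙 S) (p ≫ sq.lift)) i p
      (CartesianMonoidalCategory.fst _ _ ≫ p) := ⟨by
    ext n (x | x)
    · rfl
    · exact congrArg (fun f : S ⟶ T => f.app n x) (show p ≫ sq.lift ≫ p = p by simp)⟩
  have e₀ : ι₀ ≫ sq'.lift = 𝟙 S := by
    have := congrArg (FunctorToTypes.coprod.inl ≫ ·) sq'.fac_left
    exact this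
  have e₁ : ι₁ ≫ sq'.lift = p ≫ sq.lift := by
    have := congrArg (FunctorToTypes.coprod.inr ≫ ·) sq'.fac_left
    exact this
  exact ⟨{ h := sq'.lift, h₀ := e₀, h₁ := e₁, rel := by ext _ ⟨⟨_, ⟨⟩⟩, _⟩ }⟩

end Retraction

/-! ### Cohomology isomorphisms of simplicial sets -/

section CohomologyIso

variable (K : Type v) [Field K] {S T U : SSet.{u}}

/-- Two simplicial maps induce the same map on cohomology. -/
def Cohomologous (f g : S ⟶ T) : Prop :=
  ∀ ⦃k i j : ℤ⦄ (hk : k + 1 = i) (hj : i + 1 = j) (φ : Cochain K T i), Cochain.d K hj φ = 0 →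
    ∃ ψ : Cochain K S k, Cochain.d K hk ψ = Cochain.map K f i φ - Cochain.map K g i φ

/-- A simplicial map induces bijections on cohomology. -/
def IsCohomologyIso (f : S ⟶ T) : Prop :=
  ∀ ⦃k i j : ℤ⦄ (hk : k + 1 = i) (hj : i + 1 = j),
    (∀ z : Cochain K T i, Cochain.d K hj z = 0 →
      (∃ y : Cochain K S k, Cochain.d K hk y = Cochain.map K f i z) →
        ∃ x : Cochain K T k, Cochain.d K hk x = z) ∧
    ∀ w : Cochain K S i, Cochain.d K hj w = 0 → ∃ z : Cochain K T i, Cochain.d K hj z = 0 ∧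
      ∃ y : Cochain K S k, Cochain.d K hk y = w - Cochain.map K f i z

variable {K}

lemma IsCohomologyIso.of_inverse {f : S ⟶ T} {g : T ⟶ S} (h₁ : Cohomologous K (𝟙 S) (f ≫ g))
    (h₂ : Cohomologous K (𝟙 T) (g ≫ f)) : IsCohomologyIso K f := by
  intro k i j hk hj
  constructor
  · rintro z hz ⟨y, hy⟩
    obtain ⟨x, hx⟩ := h₂ hk hj z hz
    refine ⟨x + Cochain.map K g k y, ?_⟩
    rw [map_add, hx, ← Cochain.map_d, hy]
    exact sub_add_cancel _ _
  · intro w hw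
    obtain ⟨y, hy⟩ := h₁ hk hj w hw
    exact ⟨Cochain.map K g i w, by rw [← Cochain.map_d, hw, map_zero], y, hy⟩

lemma IsCohomologyIso.comp {f : S ⟶ T} {g : T ⟶ U} (hf : IsCohomologyIso K f)
    (hg : IsCohomologyIso K g) : IsCohomologyIso K (f ≫ g) := by
  intro k i j hk hj
  constructor
  · intro z hz hy
    exact (hg hk hj).1 z hz ((hf hk hj).1 (Cochain.map K g i z)
      (by rw [← Cochain.map_d, hz, map_zero]) hy)
  · intro w hw
    obtain ⟨z, hz, y, hy⟩ := (hf hk hj).2 w hw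
    obtain ⟨z', hz', y', hy'⟩ := (hg hk hj).2 z hz
    refine ⟨z', hz', y + Cochain.map K f k y', ?_⟩
    rw [map_add, hy, ← Cochain.map_d, hy', map_sub]
    exact sub_add_sub_cancel _ _ _

lemma Cohomologous.of_homotopy {f g : S ⟶ T} (H : SSet.Homotopy f g) : Cohomologous K f g :=
  fun _ _ _ hk hj φ hφ => exists_d_eq_sub_of_homotopy K H.toSimplicialObjectHomotopy hk hj φ hφ

lemma Cohomologous.refl (f : S ⟶ T) : Cohomologous K f f :=
  fun _ _ _ _ _ _ _ => ⟨0, by rw [map_zero, sub_self]⟩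

lemma IsCohomologyIso.of_rlp {p : S ⟶ T} (hp : SSet.modelCategoryQuillen.I.rlp p) :
    IsCohomologyIso K p := by
  obtain ⟨s, hs, ⟨H⟩⟩ := exists_homotopy_of_rlp p hp
  exact IsCohomologyIso.of_inverse (Cohomologous.of_homotopy H) (hs ▸ Cohomologous.refl _)

end CohomologyIso

/-! ### Singular cohomology and maps over the base -/

section Singular

variable {K : Type v} [Field K] {X Y Z : Type u} [TopologicalSpace X] [TopologicalSpace Y]
  [TopologicalSpace Z]

lemma IsCohomologyIso.of_homotopyInverse {f : C(Y, Z)} {g : C(Z, Y)}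
    (h₁ : (ContinuousMap.id Y).Homotopic (g.comp f))
    (h₂ : (ContinuousMap.id Z).Homotopic (f.comp g)) :
    IsCohomologyIso K (TopCat.toSSet.map (TopCat.ofHom f)) := by
  obtain ⟨H₁⟩ := h₁
  obtain ⟨H₂⟩ := h₂
  exact IsCohomologyIso.of_inverse (g := TopCat.toSSet.map (TopCat.ofHom g))
    (Cohomologous.of_homotopy (TopCat.Homotopy.toSSet (f := 𝟙 (TopCat.of Y))
      (g := TopCat.ofHom f ≫ TopCat.ofHom g) H₁))
    (Cohomologous.of_homotopy (TopCat.Homotopy.toSSet (f := 𝟙 (TopCat.of Z))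
      (g := TopCat.ofHom g ≫ TopCat.ofHom f) H₂))

/-- `f` is the inclusion by constant paths, a homotopy equivalence, followed by the end point map, a
trivial fibration on singular simplices. Both factors are cohomology isomorphisms. -/
lemma IsWeakHomotopyEquiv.isCohomologyIso {f : C(Y, Z)} (hf : IsWeakHomotopyEquiv f) :
    IsCohomologyIso K (TopCat.toSSet.map (TopCat.ofHom f)) := by
  have h₁ : IsCohomologyIso K (TopCat.toSSet.map (TopCat.ofHom (MappingPath.const f))) :=
    IsCohomologyIso.of_homotopyInverse (g := MappingPath.source f)
      (by rw [MappingPath.source_comp_const]) (MappingPath.const_comp_source_homotopic f).symm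
  have := h₁.comp (IsCohomologyIso.of_rlp hf.rlp_target)
  rwa [← Functor.map_comp, ← TopCat.ofHom_comp, MappingPath.target_comp_const] at this

/-- The inclusion of a space in its cylinder at time `t`. -/
def cylinderIncl (Y : Type u) [TopologicalSpace Y] (t : unitInterval) : C(Y, unitInterval × Y) :=
  ⟨fun y => (t, y), by fun_prop⟩

open unitInterval in
lemma cylinder_homotopic_zero (Y : Type u) [TopologicalSpace Y] :
    (ContinuousMap.id (I × Y)).Homotopic ((cylinderIncl Y 0).comp ContinuousMap.snd) :=
  ⟨{ toFun := fun p => (σ p.1 * p.2.1, p.2.2)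
     continuous_toFun := by fun_prop
     map_zero_left := fun p => by simp
     map_one_left := fun p => by simp [cylinderIncl] }⟩

open unitInterval in
lemma cylinder_homotopic_one (Y : Type u) [TopologicalSpace Y] :
    (ContinuousMap.id (I × Y)).Homotopic ((cylinderIncl Y 1).comp ContinuousMap.snd) :=
  ⟨{ toFun := fun p => (σ (σ p.1 * σ p.2.1), p.2.2)
     continuous_toFun := by fun_prop
     map_zero_left := fun p => by simp
     map_one_left := fun p => by simp [cylinderIncl] }⟩

/-- The morphism of DG modules induced by a map of spaces over `X`. -/
noncomputable def restrictHom (γ : C(Z, Y)) (α : C(Y, X)) (β : C(Z, X)) (h : α.comp γ = β) :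
    (singularCochainsMap K α).restrict ⟶ (singularCochainsMap K β).restrict where
  f := Cochain.map K (TopCat.toSSet.map (TopCat.ofHom γ))
  map_d h m := Cochain.map_d K _ h m
  map_act {i j k} e m a := by
    -- With `β` replaced by the composite, its pullback is by definition that of `α` followed by
    -- that of `γ`, so linearity is multiplicativity of the pullback along `γ`.
    subst h
    exact Cochain.map_mul K _ e m _

lemma quasiIso_restrictHom {γ : C(Z, Y)} {α : C(Y, X)} {β : C(Z, X)} (h : α.comp γ = β)
    (hγ : IsCohomologyIso K (TopCat.toSSet.map (TopCat.ofHom γ))) :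
    DGModule.quasiIso _ (restrictHom (K := K) γ α β h) :=
  (DGModule.quasiIso_iff _).2 fun hk hj => hγ hk hj

end Singular

lemma nonempty_iso_of_quasiIso {K : Type v} [Field K] {A : DGAlgebra.{v, w} K} {M N : DGModule A}
    (f : M ⟶ N) (hf : DGModule.quasiIso A f) :
    Nonempty ((DerivedCategory.Q A).obj M ≅ (DerivedCategory.Q A).obj N) := by
  have : IsIso ((DerivedCategory.Q A).map f) :=
    (DGModule.homotopyQuasiIso A).Q_inverts _ ((DGModule.homotopyQuasiIso_iff f).2 hf)
  exact ⟨asIso ((DerivedCategory.Q A).map f)⟩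

/-! ### Isomorphism invariance of levels -/

section Level

variable {T : Type*} [Category T] [HasShift T ℤ]

/-- Each thickening from the first on is an intersection of classes closed under isomorphism, so a
case distinction suffices and no induction is needed. -/
lemma thick_of_iso (Δ : Set (Pretriangulated.Triangle T)) (C : T) {M N : T} (e : M ≅ N) :
    ∀ n, thick Δ C n M → thick Δ C n N
  | 0, h => Limits.IsZero.of_iso h e.symm
  | 1, h => fun P h₁ h₂ h₃ h₄ h₅ => P.prop_of_iso e (h P h₁ h₂ h₃ h₄ h₅)
  | _ + 2, h => fun P h₁ h₂ h₃ => P.prop_of_iso e (h P h₁ h₂ h₃)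

lemma level_eq_of_iso (Δ : Set (Pretriangulated.Triangle T)) (C : T) {M N : T} (e : M ≅ N) :
    level Δ C M = level Δ C N :=
  iInf_congr fun n => iInf_congr_Prop ⟨thick_of_iso Δ C e n, thick_of_iso Δ C e.symm n⟩
    fun _ => rfl

end Level

/-! ### Levels of maps -/

section LevelOver

variable (K : Type v) [Field K] {X Y Z : Type u} [TopologicalSpace X] [TopologicalSpace Y]
  [TopologicalSpace Z]

lemma levelOver_eq_of_isCohomologyIso {γ : C(Z, Y)} {α : C(Y, X)} {β : C(Z, X)}
    (h : α.comp γ = β) (hγ : IsCohomologyIso K (TopCat.toSSet.map (TopCat.ofHom γ))) :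
    levelOver K α = levelOver K β :=
  level_eq_of_iso _ _ (nonempty_iso_of_quasiIso _ (quasiIso_restrictHom h hγ)).some

/-- The maps `α` and `β` put two different module structures on the same cochains of `Y`, so the
identity does not compare them. Both are compared with the cochains of the cylinder, which is a
space over `X` by the homotopy. -/
lemma levelOver_eq_of_homotopic {α β : C(Y, X)} (h : α.Homotopic β) :
    levelOver K α = levelOver K β := by
  obtain ⟨H⟩ := h
  have h₀ : H.toContinuousMap.comp (cylinderIncl Y 0) = α := by
    ext y
    exact H.map_zero_left y
  have h₁ : H.toContinuousMap.comp (cylinderIncl Y 1) = β := by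
    ext y
    exact H.map_one_left y
  rw [← levelOver_eq_of_isCohomologyIso K h₀
      (IsCohomologyIso.of_homotopyInverse (.refl _) (cylinder_homotopic_zero Y)),
    ← levelOver_eq_of_isCohomologyIso K h₁
      (IsCohomologyIso.of_homotopyInverse (.refl _) (cylinder_homotopic_one Y))]

end LevelOver

end DGLevel

theorem proposition2p2 {K : Type v} [Field K] {X Y Z : Type u}
    [TopologicalSpace X] [TopologicalSpace Y] [TopologicalSpace Z]
    (α : C(Y, X)) (β : C(Z, X)) (f : C(Y, Z))
    (hf : DGLevel.IsWeakHomotopyEquiv f) (h : α.Homotopic (β.comp f)) :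
    DGLevel.levelOver K β = DGLevel.levelOver K α := by
  rw [DGLevel.levelOver_eq_of_homotopic K h]
  exact DGLevel.levelOver_eq_of_isCohomologyIso K rfl hf.isCohomologyIso
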